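/- Let $G$ be a critical binary Galton–Watson tree, i.e. a Galton–Watson tree with offspring distribution $\tfrac12(\delta_0+\delta_2)$, with root $\emptyset$; add a vertex $\star$ and an edge joining $\star$ to $\emptyset$. Write $L(T)$ for the set of leaves of a tree $T$ ($\star$ is not a leaf; $\emptyset$ is a leaf if it has no children) and $N(T)$ for the set of its internal nodes (the vertices other than $\star$ and the leaves). Fix an integer $n\ge 1$ and let $G_n=\mathcal P_n(G)$ be the pruned tree obtained, conditionally on $G$, as follows. (1) Give the edges of $G$ (including $(\star,\emptyset)$) i.i.d. $\mathrm{Exp}(2)$ lengths. (2) Given $G$ and the lengths, let every internal node $x\in N(G)$ send marks forming a Poisson point process of rate $1/n$ on the branch joining $x$ to $\star$, independently for different $x$; all marks are initially active. (3) Explore the tree from the top down to $\star$ (by decreasing distance to $\star$); each time an active mark is met, remove the whole subtree above it, replace it by a leaf, and deactivate all marks sent by the nodes of the removed subtree. The resulting tree is $G_n$. There is exactly one sequence $(c^n_k)_{k\ge1}$ of nonnegative reals such that $$\sum_{k\ge1}k\,c^n_k=1,\qquad \Big(2+\frac{k-1}{n}\Big)c^n_k=\frac{1}{\sum_{l\ge1}c^n_l}\sum_{i=1}^{k-1}c^n_i\,c^n_{k-i}\quad(k\ge2);$$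 put $p^n_k=c^n_k/\sum_{l\ge1}c^n_l$ (the law of the mass of a typical particle). Almost surely $G$ is finite and each internal node sends finitely many marks (so that the exploration in (3) has finitely many steps), and: (i) for all $k\ge1$, $\displaystyle \Pr[|L(G)|=k]=p_k:=\frac{2}{4^k k}\binom{2k-2}{k-1}$; (ii) for all $k\ge1$, $\Pr[|L(G_n)|=k]=p^n_k$; that is, $|L(G_n)|$ is an exact sample of the mass of a typical particle. -/

import Mathlib

open MeasureTheory ProbabilityTheory
open scoped ENNReal NNReal

namespace ForestFire

noncomputable section

/-! ### Equilibrium of the coagulation-fragmentation equation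

Sequences `(u_k)_{k ≥ 1}` are functions `ℕ → ℝ`; the unused entry `u 0` is required to be `0`. -/

/-- The moment `m_i(u) = ∑_{k ≥ 1} k ^ i u_k` (for sequences with `u 0 = 0`). -/
def moment (i : ℕ) (u : ℕ → ℝ) : ℝ := ∑' k : ℕ, (k : ℝ) ^ i * u k

/-- `c` is an equilibrium state with total mass `1`. -/
structure IsEquilibrium (n : ℕ) (c : ℕ → ℝ) : Prop where
  zero : c 0 = 0
  nonneg : ∀ k, 0 ≤ c k
  mass : HasSum (fun k : ℕ => (k : ℝ) * c k) 1
  balance : ∀ k : ℕ, 2 ≤ k →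
    (2 + ((k : ℝ) - 1) / n) * c k
      = 1 / moment 0 c * ∑ i ∈ Finset.Ico 1 k, c i * c (k - i)

/-- The law `p_k = 2 / (4 ^ k k) * binom (2k - 2) (k - 1)`, for `k ≥ 1`. -/
def criticalLaw (k : ℕ) : ℝ :=
  2 / ((4 : ℝ) ^ k * k) * ((2 * k - 2).choose (k - 1) : ℝ)

/-! ### Trees

A vertex is a word in `List ℕ`; the root `∅` is `[]` and the `i`-th child of `u` is `u ++ [i]`.
A tree is a set of words. The extra vertex `⋆` below the root is not a word; every vertex `u` of
a tree is the upper end of exactly one edge, which joins it to its parent (to `⋆` if `u = []`),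
so edges are named by their upper ends. -/

/-- The tree in which the vertex `v` has `ξ v` children. -/
def treeOf (ξ : List ℕ → ℕ) : Set (List ℕ) := {u | ∀ v i, v ++ [i] <+: u → i < ξ v}

/-- `L(T)`: the vertices without children. -/
def leaves (T : Set (List ℕ)) : Set (List ℕ) := {u ∈ T | ∀ i, u ++ [i] ∉ T}

/-- `N(T)`: the vertices (other than `⋆`) that are not leaves. -/
def nodes (T : Set (List ℕ)) : Set (List ℕ) := T \ leaves T

/-- The offspring distribution `(δ₀ + δ₂) / 2`. -/
def offspringLaw : Measure ℕ :=
  (2 : ℝ≥0∞)⁻¹ • Measure.dirac 0 + (2 : ℝ≥0∞)⁻¹ • Measure.dirac 2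

/-- The offspring numbers `ξ v` are i.i.d. with law `(δ₀ + δ₂) / 2`, so that
`ω ↦ treeOf (ξ · ω)` is a binary critical Galton-Watson tree. -/
structure IsCriticalBinaryGW {Ω : Type*} [MeasurableSpace Ω] (P : Measure Ω)
    (ξ : List ℕ → Ω → ℕ) : Prop where
  measurable : ∀ v, Measurable (ξ v)
  law : ∀ v, P.map (ξ v) = offspringLaw
  indep : iIndepFun ξ P

/-! ### Edge lengths and marks

`κ v` is the length of the edge with upper end `v`. A point of the tree is a pair `(v, s)` with
`0 < s ≤ κ v`: the point of the edge with upper end `v` at distance `s` from its lower end. -/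

/-- The distance from `⋆` to the point `(v, s)`. -/
def distStar (κ : List ℕ → ℝ) (p : List ℕ × ℝ) : ℝ :=
  ∑ i ∈ Finset.range p.1.length, κ (p.1.take i) + p.2

/-- The branch `B(x)` joining `x` to `⋆`. -/
def branch (κ : List ℕ → ℝ) (x : List ℕ) : Set (List ℕ × ℝ) :=
  {p | p.1 <+: x ∧ 0 < p.2 ∧ p.2 ≤ κ p.1}

/-- The length of the part of the branch `B(x)` that lies in `A`. -/
def branchLength (κ : List ℕ → ℝ) (x : List ℕ) (A : Set (List ℕ × ℝ)) : ℝ≥0∞ :=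
  ∑ i ∈ Finset.range (x.length + 1),
    volume {s : ℝ | (x.take i, s) ∈ A ∩ branch κ x}

/-- A set of points is measurable if its trace on each edge is. -/
def MeasurablePoints (A : Set (List ℕ × ℝ)) : Prop :=
  ∀ v, MeasurableSet {s : ℝ | (v, s) ∈ A}

/-- The edge lengths `κ v` are i.i.d. with law `Exp(2)` and independent of the offspring
numbers `ξ`. -/
structure IsExpLengths {Ω : Type*} [MeasurableSpace Ω] (P : Measure Ω)
    (ξ : List ℕ → Ω → ℕ) (κ : List ℕ → Ω → ℝ) : Prop where
  measurable : ∀ v, Measurable (κ v)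
  law : ∀ v, P.map (κ v) = expMeasure 2
  indep : iIndepFun κ P
  indep_tree : IndepFun (fun ω v => ξ v ω) (fun ω v => κ v ω) P

/-- The sigma-algebra generated by the random tree `G` and the edge lengths `κ`. -/
abbrev sigmaTree {Ω : Type*} (G : Ω → Set (List ℕ)) (κ : List ℕ → Ω → ℝ) : MeasurableSpace Ω :=
  (⨆ v, MeasurableSpace.comap (fun ω => v ∈ G ω) inferInstance) ⊔
    ⨆ v, MeasurableSpace.comap (κ v) inferInstance

/-- Conditionally on the tree `G` and the edge lengths `κ`, the point processes `π x`, for `x`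
an internal node of `G`, are mutually independent Poisson processes with rate `1 / n` on the
branches `B(x)`: conditionally on `(G, κ)`, the numbers of points of `π x` in `A`, for finitely
many pairs `(x, A)` with the sets `A` belonging to the same `x` disjoint, are independent and
Poisson distributed with parameters `(1 / n) * length (A ∩ B(x))`. -/
structure IsPoissonMarks {Ω : Type*} [MeasurableSpace Ω] (P : Measure Ω) (n : ℕ)
    (G : Ω → Set (List ℕ)) (κ : List ℕ → Ω → ℝ)
    (π : List ℕ → Ω → Set (List ℕ × ℝ)) : Prop where
  subset_branch : ∀ x ω, x ∈ nodes (G ω) → π x ω ⊆ branch (fun v => κ v ω) x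
  measurable : ∀ x A, MeasurablePoints A → Measurable fun ω => (π x ω ∩ A).encard
  cond_law : ∀ (r : ℕ) (x : Fin r → List ℕ) (A : Fin r → Set (List ℕ × ℝ)) (m : Fin r → ℕ),
    (∀ j, MeasurablePoints (A j)) →
    (∀ i j, i ≠ j → x i = x j → Disjoint (A i) (A j)) →
    ∀ᵐ ω ∂P, (∀ j, x j ∈ nodes (G ω)) →
      (P⟦{ω' | ∀ j, (π (x j) ω' ∩ A j).encard = (m j : ℕ∞)} | sigmaTree G κ⟧) ω
        = ∏ j, (poissonMeasure
            ((branchLength (fun v => κ v ω) (x j) (A j)).toNNReal / n)).real {m j}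

/-! ### The pruning procedure -/

/-- A mark at the point `pos`, sent by the node `sender`. -/
structure Mark where
  sender : List ℕ
  pos : List ℕ × ℝ

/-- The marks sent by the internal nodes of `T`. -/
def marks (T : Set (List ℕ)) (π : List ℕ → Set (List ℕ × ℝ)) : Set Mark :=
  {m | m.sender ∈ nodes T ∧ m.pos ∈ π m.sender}

/-- The outcome for the marks in `M` when the tree is explored from the top, that is, by
decreasing distance to `⋆`. A mark `m` is still active when it is met, and is then useful
(`true`), if every mark `m'` met before it, above which the sender of `m` lies, is useless; it
has been deactivated, and is then useless (`false`), if the sender of `m` lies above a useful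
mark `m'` met before it. The vertex `x` lies above the point `(v, s)` iff `v` is a prefix of
`x`. -/
inductive Fate (κ : List ℕ → ℝ) (M : Set Mark) : Mark → Bool → Prop
  | useful (m : Mark) (hm : m ∈ M)
      (h : ∀ m' ∈ M, distStar κ m.pos < distStar κ m'.pos → m'.pos.1 <+: m.sender → Fate κ M m' false) :
      Fate κ M m true
  | useless (m m' : Mark) (hm : m ∈ M) (hm' : m' ∈ M)
      (hlt : distStar κ m.pos < distStar κ m'.pos) (habove : m'.pos.1 <+: m.sender)
      (h : Fate κ M m' true) :
      Fate κ M m false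

/-- The pruned tree: whatever lies above a useful mark is removed and replaced by a leaf. The
leaf created on an edge keeps the name of the upper end of this edge, so that a vertex `u` of
`T` remains iff there is no useful mark on the edges strictly below the one leading to `u`. -/
def prune (κ : List ℕ → ℝ) (π : List ℕ → Set (List ℕ × ℝ)) (T : Set (List ℕ)) :
    Set (List ℕ) :=
  {u ∈ T | ∀ m, Fate κ (marks T π) m true → m.pos.1 <+: u → m.pos.1 = u}

end

end ForestFire

namespace ForestFire

/-! ### Finite binary trees as sets of words -/

section Words

variable {u v : List ℕ}

/-! The exploration is recursive along the tree. When it reaches the edge below a vertex `v`, the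
only marks on that edge that can still act come from nodes that have survived above it. So the edge
is cut iff one of these survivors sends a mark there: a cut leaves no surviving node, and otherwise
the survivors are `v` and those of its two child subtrees. This is `survivors`; `isCut_iff` shows
that the top-down `Fate` obeys it, and `encard_leaves_prune` that the pruned tree has one leaf more
than it has surviving nodes.

Given the length `s` of an edge, `j` nodes send no mark on it with probability `exp (-j s / n)`;
averaging over `Exp(2)` gives `keep n j = 2 / (2 + j / n)`. Given the shape, marks on different
edges are independent, because the lengths are independent of each other and of the tree
(`measure_shapeEvent_inter_noMarks`). Hence the number of survivors obeys a product recursion on the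
shape (`measure_card_survivors`). Each finite shape has probability `weight t`, and these add up to
1 by a Catalan series (`tsum_weight`), which is almost sure finiteness.

Averaging the recursion over shapes, with probability 1/2 that the root branches, yields `q (j+1) =
keep n (j+1) / 2 * ∑ q a * q b` over `a + b = j`. In terms of `k = j + 2` leaves this is the balance
equation divided by the moment of order 0. A nonnegative solution of total mass 1 is unique because
solutions are monotone in their first entry (`IsBalanced.unique`). So the leaf law is the
normalization of any equilibrium, and dividing it by its mean produces one. -/

theorem prefix_iff_eq_or_child : v <+: u ↔ u = v ∨ ∃ i, v ++ [i] <+: u := by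
  constructor
  · rintro ⟨s, rfl⟩
    cases s with
    | nil => simp
    | cons i s => exact Or.inr ⟨i, s, by simp⟩
  · rintro (rfl | ⟨i, hi⟩)
    · exact List.prefix_refl _
    · exact (List.prefix_append v [i]).trans hi

theorem eq_of_child_prefix {i j : ℕ} (hi : v ++ [i] <+: u) (hj : v ++ [j] <+: u) : i = j := by
  have := List.prefix_of_prefix_length_le hi hj (by simp)
  simpa using this.eq_of_length (by simp)

theorem not_child_prefix_self (i : ℕ) : ¬ v ++ [i] <+: v := fun h => by
  simpa using h.length_le

theorem child_ne_self (i : ℕ) : v ++ [i] ≠ v := by simp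

theorem strict_prefix_iff : (v <+: u ∧ u ≠ v) ↔ ∃ i, v ++ [i] <+: u := by
  constructor
  · rintro ⟨h, hne⟩
    exact (prefix_iff_eq_or_child.1 h).resolve_left hne
  · rintro ⟨i, hi⟩
    exact ⟨prefix_iff_eq_or_child.2 (Or.inr ⟨i, hi⟩), by
      rintro rfl
      exact not_child_prefix_self i hi⟩

end Words

/-- The words of the binary tree `t`, planted at the word `v`. -/
def vertices : BinaryTree Unit → List ℕ → Finset (List ℕ)
  | .nil, v => {v}
  | .node _ l r, v => insert v (vertices l (v ++ [0]) ∪ vertices r (v ++ [1]))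

/-- The internal nodes of the binary tree `t`, planted at the word `v`. -/
def innerVertices : BinaryTree Unit → List ℕ → Finset (List ℕ)
  | .nil, _ => ∅
  | .node _ l r, v => insert v (innerVertices l (v ++ [0]) ∪ innerVertices r (v ++ [1]))

/-- The leaves of the binary tree `t`, planted at the word `v`. -/
def outerVertices : BinaryTree Unit → List ℕ → Finset (List ℕ)
  | .nil, v => {v}
  | .node _ l r, v => outerVertices l (v ++ [0]) ∪ outerVertices r (v ++ [1])

section Vertices

variable {t : BinaryTree Unit} {u v x : List ℕ}

theorem prefix_of_mem_vertices (h : u ∈ vertices t v) : v <+: u := by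
  induction t generalizing v with
  | nil => simp_all [vertices]
  | node _ l r hl hr =>
    simp only [vertices, Finset.mem_insert, Finset.mem_union] at h
    rcases h with rfl | h | h
    · exact List.prefix_refl _
    · exact (List.prefix_append _ _).trans (hl h)
    · exact (List.prefix_append _ _).trans (hr h)

theorem innerVertices_subset : innerVertices t v ⊆ vertices t v := by
  induction t generalizing v with
  | nil => simp [innerVertices]
  | node _ l r hl hr =>
    exact Finset.insert_subset_insert _ (Finset.union_subset_union hl hr)

theorem outerVertices_subset : outerVertices t v ⊆ vertices t v := by
  induction t generalizing v with
  | nil => simp [outerVertices, vertices]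
  | node _ l r hl hr =>
    exact (Finset.union_subset_union hl hr).trans (Finset.subset_insert _ _)

theorem prefix_of_mem_innerVertices (h : u ∈ innerVertices t v) : v <+: u :=
  prefix_of_mem_vertices (innerVertices_subset h)

theorem self_mem_vertices : v ∈ vertices t v := by
  cases t <;> simp [vertices]

theorem inner_union_outer : innerVertices t v ∪ outerVertices t v = vertices t v := by
  induction t generalizing v with
  | nil => simp [innerVertices, vertices, outerVertices]
  | node _ l r hl hr =>
    simp only [innerVertices, vertices, outerVertices, ← hl, ← hr]
    ext x
    simp only [Finset.mem_union, Finset.mem_insert]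
    tauto

theorem disjoint_of_children {i j : ℕ} (hij : i ≠ j) {A B : Finset (List ℕ)}
    (hA : ∀ x ∈ A, v ++ [i] <+: x) (hB : ∀ x ∈ B, v ++ [j] <+: x) : Disjoint A B :=
  Finset.disjoint_left.2 fun x hxA hxB => hij (eq_of_child_prefix (hA x hxA) (hB x hxB))

theorem disjoint_vertices_children (l r : BinaryTree Unit) (v : List ℕ) :
    Disjoint (vertices l (v ++ [0])) (vertices r (v ++ [1])) :=
  disjoint_of_children zero_ne_one (fun _ => prefix_of_mem_vertices)
    fun _ => prefix_of_mem_vertices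

theorem self_notMem_child {i : ℕ} {A : Finset (List ℕ)} (hA : ∀ x ∈ A, v ++ [i] <+: x) :
    v ∉ A := fun h => not_child_prefix_self i (hA v h)

theorem card_outerVertices : (outerVertices t v).card = t.numLeaves := by
  induction t generalizing v with
  | nil => simp [outerVertices]
  | node _ l r hl hr =>
    rw [outerVertices, Finset.card_union_of_disjoint, hl, hr, BinaryTree.numLeaves]
    exact (disjoint_vertices_children l r v).mono outerVertices_subset outerVertices_subset

theorem card_innerVertices : (innerVertices t v).card = t.numNodes := by
  induction t generalizing v with
  | nil => simp [innerVertices]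
  | node _ l r hl hr =>
    rw [innerVertices, Finset.card_insert_of_notMem, Finset.card_union_of_disjoint, hl, hr,
      BinaryTree.numNodes]
    · exact (disjoint_vertices_children l r v).mono innerVertices_subset innerVertices_subset
    · rw [Finset.mem_union]
      exact not_or.2 ⟨self_notMem_child fun _ => prefix_of_mem_innerVertices,
        self_notMem_child fun _ => prefix_of_mem_innerVertices⟩

theorem child_mem_vertices_iff_of_inner (hx : x ∈ innerVertices t v) (i : ℕ) :
    x ++ [i] ∈ vertices t v ↔ i < 2 := by
  induction t generalizing v with
  | nil => simp [innerVertices] at hx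
  | node _ l r hl hr =>
    simp only [innerVertices, Finset.mem_insert, Finset.mem_union] at hx
    simp only [vertices, Finset.mem_insert, Finset.mem_union]
    rcases hx with rfl | hx | hx
    · constructor
      · rintro (h | h | h)
        · simp at h
        · have := eq_of_child_prefix (prefix_of_mem_vertices h) (List.prefix_refl _)
          omega
        · have := eq_of_child_prefix (prefix_of_mem_vertices h) (List.prefix_refl _)
          omega
      · intro h
        interval_cases i
        · exact Or.inr (Or.inl self_mem_vertices)
        · exact Or.inr (Or.inr self_mem_vertices)
    · have hp := prefix_of_mem_innerVertices hx
      have h1 : x ++ [i] ≠ v := fun h => not_child_prefix_self 0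
        (h ▸ hp.trans (List.prefix_append x [i]))
      have h2 : x ++ [i] ∉ vertices r (v ++ [1]) := fun h => by
        have := eq_of_child_prefix (prefix_of_mem_vertices h)
          (hp.trans (List.prefix_append x [i]))
        omega
      simp [h1, h2, hl hx]
    · have hp := prefix_of_mem_innerVertices hx
      have h1 : x ++ [i] ≠ v := fun h => not_child_prefix_self 1
        (h ▸ hp.trans (List.prefix_append x [i]))
      have h2 : x ++ [i] ∉ vertices l (v ++ [0]) := fun h => by
        have := eq_of_child_prefix (prefix_of_mem_vertices h)
          (hp.trans (List.prefix_append x [i]))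
        omega
      simp [h1, h2, hr hx]

theorem child_notMem_vertices_of_outer (hx : x ∈ outerVertices t v) (i : ℕ) :
    x ++ [i] ∉ vertices t v := by
  induction t generalizing v with
  | nil =>
    simp only [outerVertices, Finset.mem_singleton] at hx
    simp [vertices, hx]
  | node _ l r hl hr =>
    simp only [outerVertices, Finset.mem_union] at hx
    simp only [vertices, Finset.mem_insert, Finset.mem_union, not_or]
    rcases hx with hx | hx
    · have hp := (prefix_of_mem_vertices (outerVertices_subset hx)).trans
        (List.prefix_append x [i])
      refine ⟨fun h => not_child_prefix_self 0 (h ▸ hp), hl hx, fun h => ?_⟩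
      have := eq_of_child_prefix (prefix_of_mem_vertices h) hp
      omega
    · have hp := (prefix_of_mem_vertices (outerVertices_subset hx)).trans
        (List.prefix_append x [i])
      refine ⟨fun h => not_child_prefix_self 1 (h ▸ hp), fun h => ?_, hr hx⟩
      have := eq_of_child_prefix (prefix_of_mem_vertices h) hp
      omega

theorem disjoint_inner_outer : Disjoint (innerVertices t v) (outerVertices t v) :=
  Finset.disjoint_left.2 fun _ hx hy => child_notMem_vertices_of_outer hy 0
    ((child_mem_vertices_iff_of_inner hx 0).2 two_pos)

theorem leaves_vertices (t : BinaryTree Unit) (v : List ℕ) :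
    leaves (vertices t v : Set (List ℕ)) = outerVertices t v := by
  ext x
  simp only [leaves, Finset.mem_coe, Set.mem_ofPred_eq]
  constructor
  · rintro ⟨hx, h⟩
    rw [← inner_union_outer, Finset.mem_union] at hx
    refine hx.resolve_left fun hx => h 0 ((child_mem_vertices_iff_of_inner hx 0).2 two_pos)
  · exact fun hx => ⟨outerVertices_subset hx, child_notMem_vertices_of_outer hx⟩

theorem nodes_vertices (t : BinaryTree Unit) (v : List ℕ) :
    nodes (vertices t v : Set (List ℕ)) = innerVertices t v := by
  rw [nodes, leaves_vertices, ← Finset.coe_sdiff, ← inner_union_outer,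
    Finset.union_sdiff_cancel_right disjoint_inner_outer]

theorem mem_left_iff {l r : BinaryTree Unit} {a : Unit} :
    x ∈ innerVertices l (v ++ [0]) ↔ x ∈ innerVertices (.node a l r) v ∧ v ++ [0] <+: x := by
  simp only [innerVertices, Finset.mem_insert, Finset.mem_union]
  constructor
  · exact fun h => ⟨Or.inr (Or.inl h), prefix_of_mem_innerVertices h⟩
  · rintro ⟨rfl | h | h, hp⟩
    · exact absurd hp (not_child_prefix_self 0)
    · exact h
    · exact absurd (eq_of_child_prefix hp (prefix_of_mem_innerVertices h)) zero_ne_one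

theorem mem_right_iff {l r : BinaryTree Unit} {a : Unit} :
    x ∈ innerVertices r (v ++ [1]) ↔ x ∈ innerVertices (.node a l r) v ∧ v ++ [1] <+: x := by
  simp only [innerVertices, Finset.mem_insert, Finset.mem_union]
  constructor
  · exact fun h => ⟨Or.inr (Or.inr h), prefix_of_mem_innerVertices h⟩
  · rintro ⟨rfl | h | h, hp⟩
    · exact absurd hp (not_child_prefix_self 1)
    · exact absurd (eq_of_child_prefix hp (prefix_of_mem_innerVertices h)) one_ne_zero
    · exact h

theorem innerVertices_injective {t t' : BinaryTree Unit}
    (h : innerVertices t v = innerVertices t' v) : t = t' := by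
  induction t generalizing v t' with
  | nil =>
    cases t' with
    | nil => rfl
    | node => exact absurd h.symm (by simp [innerVertices])
  | node a l r hl hr =>
    cases t' with
    | nil => exact absurd h (by simp [innerVertices])
    | node a' l' r' =>
      have h0 : l = l' := hl (v := v ++ [0]) <| Finset.ext fun x => by
        rw [mem_left_iff (a := a) (r := r), mem_left_iff (a := a') (r := r'), h]
      have h1 : r = r' := hr (v := v ++ [1]) <| Finset.ext fun x => by
        rw [mem_right_iff (a := a) (l := l), mem_right_iff (a := a') (l := l'), h]
      rw [h0, h1]

/-- Gives both the disjointness of the shape events and the countability of the set of binary trees.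
-/
theorem vertices_injective {t t' : BinaryTree Unit} (h : vertices t v = vertices t' v) :
    t = t' := by
  have := nodes_vertices t v
  rw [h, nodes_vertices] at this
  exact (innerVertices_injective (Finset.coe_injective this)).symm

end Vertices

/-! ### Recognizing a finite shape from finitely many offspring numbers. -/

section TreeOf

variable {ξ : List ℕ → ℕ} {t : BinaryTree Unit} {u v : List ℕ}

theorem nil_mem_treeOf : [] ∈ treeOf ξ := by
  intro v i h
  simpa using h.length_le

theorem child_mem_treeOf_iff {i : ℕ} : v ++ [i] ∈ treeOf ξ ↔ v ∈ treeOf ξ ∧ i < ξ v := by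
  constructor
  · exact fun h => ⟨fun w j hw => h w j (hw.trans (List.prefix_append _ _)),
      h v i (List.prefix_refl _)⟩
  · rintro ⟨h, hi⟩ w j hw
    rcases List.prefix_concat_iff.1 hw with hw | hw
    · obtain ⟨rfl, hj⟩ := List.append_inj' hw rfl
      simp only [List.cons.injEq, and_true] at hj
      exact hj ▸ hi
    · exact h w j hw

theorem mem_treeOf_iff_mem_vertices (hin : ∀ x ∈ innerVertices t v, ξ x = 2)
    (hout : ∀ x ∈ outerVertices t v, ξ x = 0) (hv : v ∈ treeOf ξ) (hu : v <+: u) :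
    u ∈ treeOf ξ ↔ u ∈ vertices t v := by
  induction t generalizing v with
  | nil =>
    simp only [outerVertices, Finset.mem_singleton, forall_eq] at hout
    simp only [vertices, Finset.mem_singleton]
    rcases prefix_iff_eq_or_child.1 hu with rfl | ⟨i, hi⟩
    · simp [hv]
    · constructor
      · intro h
        have := h v i hi
        omega
      · rintro rfl
        exact hv
  | node a l r hl hr =>
    have h2 : ξ v = 2 := hin v (by simp [innerVertices])
    have hv0 : v ++ [0] ∈ treeOf ξ := child_mem_treeOf_iff.2 ⟨hv, by omega⟩
    have hv1 : v ++ [1] ∈ treeOf ξ := child_mem_treeOf_iff.2 ⟨hv, by omega⟩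
    have hin0 : ∀ x ∈ innerVertices l (v ++ [0]), ξ x = 2 := fun x hx =>
      hin x (mem_left_iff.1 hx).1
    have hin1 : ∀ x ∈ innerVertices r (v ++ [1]), ξ x = 2 := fun x hx =>
      hin x (mem_right_iff.1 hx).1
    simp only [outerVertices, Finset.mem_union] at hout
    have hl' := fun hu => hl (v := v ++ [0]) hin0 (fun x hx => hout x (Or.inl hx)) hv0 hu
    have hr' := fun hu => hr (v := v ++ [1]) hin1 (fun x hx => hout x (Or.inr hx)) hv1 hu
    simp only [vertices, Finset.mem_insert, Finset.mem_union]
    constructor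
    · intro h
      rcases prefix_iff_eq_or_child.1 hu with rfl | ⟨i, hi⟩
      · exact Or.inl rfl
      · have := h v i hi
        rw [h2] at this
        interval_cases i
        · exact Or.inr (Or.inl ((hl' hi).1 h))
        · exact Or.inr (Or.inr ((hr' hi).1 h))
    · rintro (rfl | h | h)
      · exact hv
      · exact (hl' (prefix_of_mem_vertices h)).2 h
      · exact (hr' (prefix_of_mem_vertices h)).2 h

theorem treeOf_eq_vertices_iff :
    treeOf ξ = vertices t [] ↔
      (∀ x ∈ innerVertices t [], ξ x = 2) ∧ ∀ x ∈ outerVertices t [], ξ x = 0 := by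
  constructor
  · intro h
    have key : ∀ x ∈ vertices t [], ∀ i, x ++ [i] ∈ vertices t [] ↔ i < ξ x := by
      intro x hx i
      rw [← Finset.mem_coe, ← h] at hx ⊢
      simp [child_mem_treeOf_iff, hx]
    constructor
    · intro x hx
      have := fun i => (key x (innerVertices_subset hx) i).symm.trans
        (child_mem_vertices_iff_of_inner hx i)
      have h1 := this 1
      have h2 := this 2
      omega
    · intro x hx
      have h1 := key x (outerVertices_subset hx) 0
      have h2 := child_notMem_vertices_of_outer hx 0
      rw [h1] at h2
      omega
  · rintro ⟨h1, h2⟩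
    ext u
    exact mem_treeOf_iff_mem_vertices h1 h2 nil_mem_treeOf List.nil_prefix

end TreeOf

/-! ### Useful marks -/

section Fate

variable {κ : List ℕ → ℝ} {M : Set Mark} {m : Mark}

theorem Fate.mem {b : Bool} (h : Fate κ M m b) : m ∈ M := by
  cases h <;> assumption

theorem Fate.not_true_of_false (h : Fate κ M m false) : ¬ Fate κ M m true := by
  -- Stating the claim for both truth values lets a single induction handle the two alternating
  -- cases.
  suffices ∀ m b, Fate κ M m b → Fate κ M m (!b) → False from fun h' => this m false h h'
  intro m b h
  induction h with
  | useful m hm h ih =>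
    rintro (_ | ⟨_, m', _, hm', hlt, hab, h'⟩)
    exact ih m' hm' hlt hab h'
  | useless m m' hm hm' hlt hab h ih =>
    rintro (⟨_, _, h'⟩ | _)
    exact ih (h' m' hm' hlt hab)

/-- Finiteness makes "farther from `⋆`" well founded, so the exploration has a first step and every
mark gets an outcome. -/
theorem fate_total (hM : M.Finite) (hm : m ∈ M) : Fate κ M m true ∨ Fate κ M m false := by
  have hwf : WellFounded fun a b : M => distStar κ b.1.pos < distStar κ a.1.pos := by
    have := hM.to_subtype
    have : IsTrans M fun a b : M => distStar κ b.1.pos < distStar κ a.1.pos :=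
      ⟨fun _ _ _ h1 h2 => h2.trans h1⟩
    have : Std.Irrefl fun a b : M => distStar κ b.1.pos < distStar κ a.1.pos :=
      ⟨fun _ => lt_irrefl _⟩
    exact Finite.wellFounded_of_trans_of_irrefl _
  suffices ∀ m : M, Fate κ M m true ∨ Fate κ M m false from this ⟨m, hm⟩
  intro m
  induction m using hwf.induction with
  | _ m ih =>
    by_cases h : ∀ m' ∈ M, distStar κ m.1.pos < distStar κ m'.pos → m'.pos.1 <+: m.1.sender →
        Fate κ M m' false
    · exact Or.inl (.useful _ m.2 h)
    · push Not at h
      obtain ⟨m', hm', hlt, hab, hf⟩ := h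
      exact Or.inr (.useless _ m' m.2 hm' hlt hab ((ih ⟨m', hm'⟩ hlt).resolve_right hf))

/-- Some useful mark lies on the edge with upper end `v`. -/
def IsCut (κ : List ℕ → ℝ) (M : Set Mark) (v : List ℕ) : Prop :=
  ∃ m, Fate κ M m true ∧ m.pos.1 = v

theorem mem_prune_iff {π : List ℕ → Set (List ℕ × ℝ)} {T : Set (List ℕ)} {u : List ℕ} :
    u ∈ prune κ π T ↔ u ∈ T ∧ ∀ v, IsCut κ (marks T π) v → v <+: u → v = u := by
  simp only [prune, Set.mem_ofPred_eq, IsCut]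
  refine and_congr_right fun _ => ⟨?_, ?_⟩
  · rintro h v ⟨m, hm, rfl⟩
    exact h m hm
  · exact fun h m hm => h _ ⟨m, hm, rfl⟩

theorem distStar_lt_of_strict_prefix (hκ : ∀ v, 0 < κ v) {v u : List ℕ} {s s' : ℝ}
    (hs : s ≤ κ v) (hs' : 0 < s') (hvu : v <+: u) (hne : u ≠ v) :
    distStar κ (v, s) < distStar κ (u, s') := by
  have hlen : v.length < u.length := by
    refine lt_of_le_of_ne hvu.length_le fun h => hne (hvu.eq_of_length h).symm
  have hv : u.take v.length = v := (List.prefix_iff_eq_take.1 hvu).symm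
  have h1 : ∑ i ∈ Finset.range v.length, κ (v.take i)
      = ∑ i ∈ Finset.range v.length, κ (u.take i) := by
    refine Finset.sum_congr rfl fun i hi => ?_
    rw [Finset.mem_range] at hi
    conv_lhs => rw [← hv]
    rw [List.take_take, min_eq_left hi.le]
  have h2 : ∑ i ∈ Finset.range (v.length + 1), κ (u.take i)
      ≤ ∑ i ∈ Finset.range u.length, κ (u.take i) :=
    Finset.sum_le_sum_of_subset_of_nonneg (Finset.range_subset_range.2 hlen)
      fun i _ _ => (hκ _).le
  rw [Finset.sum_range_succ, hv] at h2
  simp only [distStar]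
  linarith

/-- Positions within an edge drop out: whether an edge is cut depends only on which nodes send marks
on it and on the cuts above it. This recursion is all that is used about `Fate` afterwards. -/
theorem isCut_iff {T : Set (List ℕ)} {π : List ℕ → Set (List ℕ × ℝ)} (hκ : ∀ v, 0 < κ v)
    (hsub : ∀ x ∈ nodes T, π x ⊆ branch κ x) (hfin : (marks T π).Finite) (v : List ℕ) :
    IsCut κ (marks T π) v ↔ ∃ x ∈ nodes T, (∃ s, (v, s) ∈ π x) ∧
      ∀ u, v <+: u → u ≠ v → u <+: x → ¬ IsCut κ (marks T π) u := by
  have hpos : ∀ m ∈ marks T π, m.pos.1 <+: m.sender ∧ 0 < m.pos.2 ∧ m.pos.2 ≤ κ m.pos.1 :=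
    fun m hm => hsub _ hm.1 hm.2
  have hlt : ∀ m ∈ marks T π, ∀ m' ∈ marks T π, m.pos.1 <+: m'.pos.1 → m'.pos.1 ≠ m.pos.1 →
      distStar κ m.pos < distStar κ m'.pos := fun m hm m' hm' =>
    distStar_lt_of_strict_prefix hκ (hpos m hm).2.2 (hpos m' hm').2.1
  constructor
  · rintro ⟨m, hm, rfl⟩
    refine ⟨m.sender, hm.mem.1, ⟨m.pos.2, hm.mem.2⟩, ?_⟩
    rintro _ hu hne hux ⟨m', hm', rfl⟩
    exact (Fate.useless m m' hm.mem hm'.mem (hlt m hm.mem m' hm'.mem hu hne) hux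
      hm').not_true_of_false hm
  · rintro ⟨x, hx, ⟨s, hs⟩, hcut⟩
    -- Among the marks on the edge whose sender is not cut off by a higher edge, the one met first
    -- is useful. A mark met earlier on the same edge has its sender cut off, by maximality, and so
    -- is useless. One on another edge below the sender is either lower, hence not met earlier, or
    -- higher, where a useful mark is excluded by `hmcut`.
    obtain ⟨m, ⟨hmM, rfl, hmcut⟩, hmax⟩ := Set.exists_max_image
      {m | m ∈ marks T π ∧ m.pos.1 = v ∧
        ∀ u, v <+: u → u ≠ v → u <+: m.sender → ¬ IsCut κ (marks T π) u}
      (fun m => distStar κ m.pos) (hfin.subset fun m hm => hm.1) ⟨⟨x, (v, s)⟩, ⟨hx, hs⟩, rfl, hcut⟩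
    refine ⟨m, .useful m hmM fun m' hm' hd hab => ?_, rfl⟩
    by_cases hne : m'.pos.1 = m.pos.1
    · by_cases hd' : ∀ u, m.pos.1 <+: u → u ≠ m.pos.1 → u <+: m'.sender →
          ¬ IsCut κ (marks T π) u
      · exact absurd hd (not_lt.2 (hmax m' ⟨hm', hne, hd'⟩))
      · push Not at hd'
        obtain ⟨u, hu, hune, hux, m'', hm'', rfl⟩ := hd'
        rw [← hne] at hu hune
        exact .useless m' m'' hm' hm''.mem (hlt m' hm' m'' hm''.mem hu hune) hux hm''
    · refine (fate_total hfin hm').resolve_left fun h => ?_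
      rcases List.prefix_or_prefix_of_prefix hab (hpos m hmM).1 with h' | h'
      · exact absurd hd (not_lt.2 (hlt m' hm' m hmM h' (Ne.symm hne)).le)
      · exact hmcut _ h' hne hab ⟨m', h, rfl⟩

end Fate

/-! ### The surviving nodes -/

open Classical in
/-- The internal nodes of `t` (planted at `v`) that have not been removed when the exploration
reaches the lower end of the edge with upper end `v`, where `Z x u` says that the node `x` sends
no mark on the edge with upper end `u`. -/
noncomputable def survivors (Z : List ℕ → List ℕ → Prop) :
    BinaryTree Unit → List ℕ → Finset (List ℕ)
  | .nil, _ => ∅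
  | .node _ l r, v =>
    if ∀ x ∈ insert v (survivors Z l (v ++ [0]) ∪ survivors Z r (v ++ [1])), Z x v then
      insert v (survivors Z l (v ++ [0]) ∪ survivors Z r (v ++ [1])) else ∅

section Survivors

variable {Z : List ℕ → List ℕ → Prop} {t : BinaryTree Unit} {v : List ℕ}

theorem survivors_subset : survivors Z t v ⊆ innerVertices t v := by
  induction t generalizing v with
  | nil => simp [survivors]
  | node _ l r hl hr =>
    rw [survivors]
    split_ifs
    · exact Finset.insert_subset_insert _ (Finset.union_subset_union hl hr)
    · exact Finset.empty_subset _

theorem card_insert_union_of_subset {l r : BinaryTree Unit} {A B : Finset (List ℕ)}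
    (hA : A ⊆ innerVertices l (v ++ [0])) (hB : B ⊆ innerVertices r (v ++ [1])) :
    (insert v (A ∪ B)).card = A.card + B.card + 1 := by
  rw [Finset.card_insert_of_notMem, Finset.card_union_of_disjoint]
  · exact (disjoint_vertices_children l r v).mono (hA.trans innerVertices_subset)
      (hB.trans innerVertices_subset)
  · rw [Finset.mem_union]
    exact not_or.2 ⟨self_notMem_child fun _ h => prefix_of_mem_innerVertices (hA h),
      self_notMem_child fun _ h => prefix_of_mem_innerVertices (hB h)⟩

variable {C : List ℕ → Prop}

/-- The hypothesis `hC` determines `C` from the top down, and the recursion for `survivors` follows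
the same order. `N` stays the full set of nodes while `t` shrinks to a subtree, so that `hC` can be
reused unchanged. -/
theorem mem_survivors_iff {N : Set (List ℕ)}
    (hC : ∀ v, C v ↔ ∃ x ∈ N, v <+: x ∧ ¬ Z x v ∧ ∀ u, v <+: u → u ≠ v → u <+: x → ¬ C u)
    (hN : ∀ x, x ∈ innerVertices t v ↔ x ∈ N ∧ v <+: x) {x : List ℕ} :
    x ∈ survivors Z t v ↔ x ∈ innerVertices t v ∧ ∀ u, v <+: u → u <+: x → ¬ C u := by
  induction t generalizing v x with
  | nil => simp [survivors, innerVertices]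
  | node a l r hl hr =>
    have hN0 : ∀ x, x ∈ innerVertices l (v ++ [0]) ↔ x ∈ N ∧ v ++ [0] <+: x := fun x => by
      rw [mem_left_iff (a := a) (r := r), hN, and_assoc, and_congr_right_iff]
      exact fun _ => and_iff_right_of_imp (List.prefix_append _ _).trans
    have hN1 : ∀ x, x ∈ innerVertices r (v ++ [1]) ↔ x ∈ N ∧ v ++ [1] <+: x := fun x => by
      rw [mem_right_iff (a := a) (l := l), hN, and_assoc, and_congr_right_iff]
      exact fun _ => and_iff_right_of_imp (List.prefix_append _ _).trans
    have hmem : ∀ x, x ∈ insert v (survivors Z l (v ++ [0]) ∪ survivors Z r (v ++ [1])) ↔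
        x ∈ innerVertices (.node a l r) v ∧ ∀ u, v <+: u → u ≠ v → u <+: x → ¬ C u := by
      intro x
      rw [Finset.mem_insert, Finset.mem_union, hl hN0, hr hN1, innerVertices, Finset.mem_insert,
        Finset.mem_union]
      constructor
      · rintro (rfl | ⟨hx, h⟩ | ⟨hx, h⟩)
        · refine ⟨Or.inl rfl, fun u hu hne hux => absurd ?_ hne⟩
          exact hux.eq_of_length (le_antisymm hux.length_le hu.length_le)
        · refine ⟨Or.inr (Or.inl hx), fun u hu hne hux => h u ?_ hux⟩
          obtain ⟨i, hi⟩ := strict_prefix_iff.1 ⟨hu, hne⟩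
          rwa [eq_of_child_prefix (hi.trans hux) (prefix_of_mem_innerVertices hx)] at hi
        · refine ⟨Or.inr (Or.inr hx), fun u hu hne hux => h u ?_ hux⟩
          obtain ⟨i, hi⟩ := strict_prefix_iff.1 ⟨hu, hne⟩
          rwa [eq_of_child_prefix (hi.trans hux) (prefix_of_mem_innerVertices hx)] at hi
      · rintro ⟨rfl | hx | hx, h⟩
        · exact Or.inl rfl
        · refine Or.inr (Or.inl ⟨hx, fun u hu hux => ?_⟩)
          have := strict_prefix_iff.2 ⟨0, hu⟩
          exact h u this.1 this.2 hux
        · refine Or.inr (Or.inr ⟨hx, fun u hu hux => ?_⟩)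
          have := strict_prefix_iff.2 ⟨1, hu⟩
          exact h u this.1 this.2 hux
    have hCv : ¬ C v ↔
        ∀ x ∈ insert v (survivors Z l (v ++ [0]) ∪ survivors Z r (v ++ [1])), Z x v := by
      rw [hC v]
      push Not
      constructor
      · intro h x hx
        rw [hmem, hN] at hx
        by_contra hZ
        obtain ⟨u, hu, hne, hux, hCu⟩ := h x hx.1.1 hx.1.2 hZ
        exact hx.2 u hu hne hux hCu
      · intro h x hxN hvx hZ
        by_contra! hcon
        exact hZ (h x ((hmem x).2 ⟨(hN x).2 ⟨hxN, hvx⟩, hcon⟩))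
    rw [survivors]
    split_ifs with h
    · rw [hmem]
      refine and_congr_right fun hx => ⟨fun hu u hvu hux => ?_, fun hu u hvu _ => hu u hvu⟩
      by_cases hne : u = v
      · exact hne ▸ hCv.2 h
      · exact hu u hvu hne hux
    · simp only [Finset.notMem_empty, false_iff, not_and]
      intro hx hu
      exact h (hCv.1 (hu v (List.prefix_refl _) (prefix_of_mem_innerVertices hx)))

theorem survivors_node_eq_empty_or {l r : BinaryTree Unit} {a : Unit} :
    survivors Z (.node a l r) v = ∅ ∨ survivors Z (.node a l r) v =
      insert v (survivors Z l (v ++ [0]) ∪ survivors Z r (v ++ [1])) := by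
  rw [survivors]
  split_ifs <;> simp

/-- If the edge is cut, `v` is the only leaf left above it and no node survives. Otherwise the
leaves of the two child subtrees add up, and `(a + 1) + (b + 1) = (a + b + 1) + 1`. The hypothesis
`hv` says that `v` itself has not been removed by a cut further down. -/
theorem encard_leaves_above {T N : Set (List ℕ)}
    (hC : ∀ v, C v ↔ ∃ x ∈ N, v <+: x ∧ ¬ Z x v ∧ ∀ u, v <+: u → u ≠ v → u <+: x → ¬ C u)
    (hT : ∀ x, x ∈ vertices t v ↔ x ∈ T ∧ v <+: x)
    (hN : ∀ x, x ∈ innerVertices t v ↔ x ∈ N ∧ v <+: x)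
    (hv : ∀ u, C u → u <+: v → u = v) :
    {u | u ∈ leaves {u ∈ T | ∀ w, C w → w <+: u → w = u} ∧ v <+: u}.encard
      = ((survivors Z t v).card + 1 : ℕ) := by
  have child : ∀ v, (∀ u, C u → u <+: v → u = v) → ∀ i,
      (v ++ [i] ∈ {u ∈ T | ∀ w, C w → w <+: u → w = u} ↔ v ++ [i] ∈ T ∧ ¬ C v) := by
    intro v hv i
    refine and_congr_right fun _ => ⟨fun h hCv => ?_, fun h w hw hwi => ?_⟩
    · exact child_ne_self i (h v hCv (List.prefix_append _ _)).symm
    · rcases List.prefix_concat_iff.1 hwi with h' | h'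
      · exact h'
      · exact absurd (hv w hw h' ▸ hw) h
  induction t generalizing v with
  | nil =>
    have hvT : v ∈ T := ((hT v).1 self_mem_vertices).1
    have : {u | u ∈ leaves {u ∈ T | ∀ w, C w → w <+: u → w = u} ∧ v <+: u} = {v} := by
      simp only [vertices, Finset.mem_singleton] at hT
      ext u
      simp only [Set.mem_ofPred_eq, Set.mem_singleton_iff]
      constructor
      · rintro ⟨⟨hu, -⟩, hvu⟩
        exact (hT u).2 ⟨hu.1, hvu⟩
      · rintro rfl
        refine ⟨⟨⟨hvT, hv⟩, fun i hi => ?_⟩, List.prefix_refl _⟩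
        exact child_ne_self i ((hT _).2 ⟨hi.1, List.prefix_append _ _⟩)
    rw [this]
    simp [survivors]
  | node a l r hl hr =>
    have hvT : v ∈ T := ((hT v).1 self_mem_vertices).1
    have hmem := fun x => mem_survivors_iff (x := x) hC hN
    have hsub : ∀ i, i < 2 ↔ v ++ [i] ∈ T := fun i => by
      rw [← child_mem_vertices_iff_of_inner (t := .node a l r) (v := v) (x := v)
        (by simp [innerVertices]), hT]
      simp
    by_cases hCv : C v
    · have h0 : survivors Z (.node a l r) v = ∅ := by
        rw [Finset.eq_empty_iff_forall_notMem]
        intro x hx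
        rw [hmem] at hx
        exact hx.2 v (List.prefix_refl _) (prefix_of_mem_innerVertices hx.1) hCv
      have : {u | u ∈ leaves {u ∈ T | ∀ w, C w → w <+: u → w = u} ∧ v <+: u} = {v} := by
        ext u
        simp only [Set.mem_ofPred_eq, Set.mem_singleton_iff]
        constructor
        · rintro ⟨⟨hu, -⟩, hvu⟩
          exact (hu.2 v hCv hvu).symm
        · rintro rfl
          exact ⟨⟨⟨hvT, hv⟩, fun i hi => ((child _ hv i).1 hi).2 hCv⟩, List.prefix_refl _⟩
      rw [this, h0]
      simp
    · have hmv : v ∈ survivors Z (.node a l r) v := by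
        rw [hmem]
        refine ⟨by simp [innerVertices], fun u hvu huv => ?_⟩
        rwa [huv.eq_of_length (le_antisymm huv.length_le hvu.length_le)]
      have hs := (survivors_node_eq_empty_or (Z := Z) (v := v) (a := a) (l := l)
        (r := r)).resolve_left (Finset.ne_empty_of_mem hmv)
      have hchild : ∀ i < 2, ∀ u, C u → u <+: v ++ [i] → u = v ++ [i] := fun i hi =>
        ((child _ hv i).2 ⟨(hsub i).1 hi, hCv⟩).2
      have hT0 : ∀ x, x ∈ vertices l (v ++ [0]) ↔ x ∈ T ∧ v ++ [0] <+: x := fun x => by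
        constructor
        · intro h
          refine ⟨((hT x).1 ?_).1, prefix_of_mem_vertices h⟩
          simp [vertices, h]
        · rintro ⟨h, hp⟩
          have := (hT x).2 ⟨h, (List.prefix_append _ _).trans hp⟩
          simp only [vertices, Finset.mem_insert, Finset.mem_union] at this
          rcases this with rfl | h | h
          · exact absurd hp (not_child_prefix_self 0)
          · exact h
          · exact absurd (eq_of_child_prefix hp (prefix_of_mem_vertices h)) zero_ne_one
      have hT1 : ∀ x, x ∈ vertices r (v ++ [1]) ↔ x ∈ T ∧ v ++ [1] <+: x := fun x => by
        constructor
        · intro h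
          refine ⟨((hT x).1 ?_).1, prefix_of_mem_vertices h⟩
          simp [vertices, h]
        · rintro ⟨h, hp⟩
          have := (hT x).2 ⟨h, (List.prefix_append _ _).trans hp⟩
          simp only [vertices, Finset.mem_insert, Finset.mem_union] at this
          rcases this with rfl | h | h
          · exact absurd hp (not_child_prefix_self 1)
          · exact absurd (eq_of_child_prefix hp (prefix_of_mem_vertices h)) one_ne_zero
          · exact h
      have hN0 : ∀ x, x ∈ innerVertices l (v ++ [0]) ↔ x ∈ N ∧ v ++ [0] <+: x := fun x => by
        rw [mem_left_iff (a := a) (r := r), hN, and_assoc, and_congr_right_iff]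
        exact fun _ => and_iff_right_of_imp (List.prefix_append _ _).trans
      have hN1 : ∀ x, x ∈ innerVertices r (v ++ [1]) ↔ x ∈ N ∧ v ++ [1] <+: x := fun x => by
        rw [mem_right_iff (a := a) (l := l), hN, and_assoc, and_congr_right_iff]
        exact fun _ => and_iff_right_of_imp (List.prefix_append _ _).trans
      have hunion : {u | u ∈ leaves {u ∈ T | ∀ w, C w → w <+: u → w = u} ∧ v <+: u} =
          {u | u ∈ leaves {u ∈ T | ∀ w, C w → w <+: u → w = u} ∧ v ++ [0] <+: u} ∪
          {u | u ∈ leaves {u ∈ T | ∀ w, C w → w <+: u → w = u} ∧ v ++ [1] <+: u} := by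
        ext u
        simp only [Set.mem_ofPred_eq, Set.mem_union]
        rw [← and_or_left]
        refine and_congr_right fun hu => ⟨fun h => ?_, ?_⟩
        · rcases prefix_iff_eq_or_child.1 h with rfl | ⟨i, hi⟩
          · exact absurd ((child _ hv 0).2 ⟨(hsub 0).1 two_pos, hCv⟩) (hu.2 0)
          · have huT := (hT u).2 ⟨hu.1.1, h⟩
            simp only [vertices, Finset.mem_insert, Finset.mem_union] at huT
            rcases huT with rfl | h | h
            · exact absurd hi (not_child_prefix_self i)
            · exact Or.inl (prefix_of_mem_vertices h)
            · exact Or.inr (prefix_of_mem_vertices h)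
        · rintro (h | h) <;> exact (List.prefix_append _ _).trans h
      rw [hunion, Set.encard_union_eq, hl hT0 hN0 (hchild 0 two_pos),
          hr hT1 hN1 (hchild 1 one_lt_two), hs, card_insert_union_of_subset survivors_subset survivors_subset]
      · push_cast
        ring
      · rw [Set.disjoint_left]
        rintro u ⟨-, h0⟩ ⟨-, h1⟩
        exact zero_ne_one (eq_of_child_prefix h0 h1)

end Survivors

theorem encard_leaves_prune {κ : List ℕ → ℝ} {π : List ℕ → Set (List ℕ × ℝ)}
    {t : BinaryTree Unit} (hκ : ∀ v, 0 < κ v)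
    (hsub : ∀ x ∈ innerVertices t [], π x ⊆ branch κ x)
    (hfin : ∀ x ∈ innerVertices t [], (π x).Finite) :
    (leaves (prune κ π (vertices t []))).encard
      = ((survivors (fun x v => ∀ s, (v, s) ∉ π x) t []).card + 1 : ℕ) := by
  have hnodes := nodes_vertices t []
  have hsub' : ∀ x ∈ nodes (vertices t [] : Set (List ℕ)), π x ⊆ branch κ x := fun x hx =>
    hsub x (by simpa [hnodes] using hx)
  have hM : (marks (vertices t []) π).Finite := by
    have : marks (vertices t []) π ⊆
        ⋃ x ∈ innerVertices t [], (fun p => Mark.mk x p) '' π x := by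
      rintro ⟨x, p⟩ ⟨hx, hp⟩
      rw [hnodes] at hx
      exact Set.mem_biUnion hx ⟨p, hp, rfl⟩
    exact ((innerVertices t []).finite_toSet.biUnion fun x hx => (hfin x hx).image _).subset this
  rw [← encard_leaves_above (T := vertices t []) (N := innerVertices t [])
    (C := IsCut κ (marks (vertices t []) π))]
  · congr 1
    ext u
    have : prune κ π (vertices t []) = {u | u ∈ (vertices t [] : Set (List ℕ)) ∧
        ∀ w, IsCut κ (marks (vertices t []) π) w → w <+: u → w = u} := by
      ext u
      exact mem_prune_iff
    simp [this]
  · intro v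
    rw [isCut_iff hκ hsub' hM, hnodes]
    constructor
    · rintro ⟨x, hx, ⟨s, hs⟩, h⟩
      exact ⟨x, hx, (hsub x hx hs).1, fun hZ => hZ s hs, h⟩
    · rintro ⟨x, hx, -, hZ, h⟩
      push Not at hZ
      exact ⟨x, hx, hZ, h⟩
  · simp
  · simp
  · exact fun u _ hu => List.prefix_nil.1 hu

/-! ### The law of the shape of the tree -/

section Weight

/-- A Wallis-type bound, proved by induction from `(2k+1)(2k+3) ≤ 4(k+1)^2`; it is just strong
enough for the central binomial coefficients to be negligible against `4 ^ k`. -/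
theorem sq_centralBinom_mul_le (k : ℕ) : (k.centralBinom : ℝ) ^ 2 * (2 * k + 1) ≤ (4 ^ k) ^ 2 := by
  induction k with
  | zero => simp
  | succ k ih =>
    have h : ((k : ℝ) + 1) * (k + 1).centralBinom = 2 * (2 * k + 1) * k.centralBinom := by
      exact_mod_cast Nat.succ_mul_centralBinom_succ k
    have hk : (0 : ℝ) < (k + 1) ^ 2 := by positivity
    refine le_of_mul_le_mul_left ?_ hk
    calc ((k : ℝ) + 1) ^ 2 * (((k + 1).centralBinom : ℝ) ^ 2 * (2 * (k + 1 : ℕ) + 1))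
        = (((k : ℝ) + 1) * (k + 1).centralBinom) ^ 2 * (2 * k + 3) := by push_cast; ring
      _ = 4 * ((2 * (k : ℝ) + 1) * (2 * k + 3)) * ((k.centralBinom : ℝ) ^ 2 * (2 * k + 1)) := by
        rw [h]; ring
      _ ≤ 4 * ((2 * (k : ℝ) + 1) * (2 * k + 3)) * (4 ^ k) ^ 2 := by gcongr
      _ ≤ 4 * (4 * ((k : ℝ) + 1) ^ 2) * (4 ^ k) ^ 2 :=
        mul_le_mul_of_nonneg_right (by nlinarith) (by positivity)
      _ = ((k : ℝ) + 1) ^ 2 * (4 ^ (k + 1)) ^ 2 := by ring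

theorem tendsto_centralBinom_div :
    Filter.Tendsto (fun k : ℕ => (k.centralBinom : ℝ) / 4 ^ k) Filter.atTop (nhds 0) := by
  have h : Filter.Tendsto (fun k : ℕ => Real.sqrt (1 / ((k : ℝ) + 1))) Filter.atTop (nhds 0) := by
    simpa using (tendsto_one_div_add_atTop_nhds_zero_nat (𝕜 := ℝ)).sqrt
  refine squeeze_zero (fun k => by positivity) (fun k => ?_) h
  refine Real.le_sqrt_of_sq_le ?_
  rw [div_pow, div_le_div_iff₀ (by positivity) (by positivity), one_mul]
  refine le_trans ?_ (sq_centralBinom_mul_le k)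
  gcongr
  linarith [(Nat.cast_nonneg k : (0 : ℝ) ≤ k)]

/-- The partial sums telescope to `1 - centralBinom N / 4 ^ N`. -/
theorem hasSum_catalan : HasSum (fun k : ℕ => (catalan k : ℝ) / 2 ^ (2 * k + 1)) 1 := by
  rw [hasSum_iff_tendsto_nat_of_nonneg (fun k => by positivity)]
  have : ∀ N : ℕ, ∑ k ∈ Finset.range N, (catalan k : ℝ) / 2 ^ (2 * k + 1)
      = 1 - (N.centralBinom : ℝ) / 4 ^ N := by
    intro N
    induction N with
    | zero => simp
    | succ N ih =>
      have h1 : ((N : ℝ) + 1) * catalan N = N.centralBinom := by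
        exact_mod_cast succ_mul_catalan_eq_centralBinom N
      have h2 : ((N : ℝ) + 1) * (N + 1).centralBinom = 2 * (2 * N + 1) * N.centralBinom := by
        exact_mod_cast Nat.succ_mul_centralBinom_succ N
      have h3 : ((N + 1).centralBinom : ℝ) = 2 * (2 * N + 1) * catalan N := by
        have : (N : ℝ) + 1 ≠ 0 := by positivity
        apply mul_left_cancel₀ this
        rw [h2, ← h1]; ring
      rw [Finset.sum_range_succ, ih, h3, ← h1, pow_succ, pow_mul, pow_succ]
      norm_num
      field_simp
      ring
  simp_rw [this]
  simpa using tendsto_centralBinom_div.const_sub 1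

/-- The probability that a critical binary Galton-Watson tree has the shape `t`. -/
noncomputable def weight (t : BinaryTree Unit) : ℝ≥0∞ := (2 ^ (2 * t.numNodes + 1))⁻¹

theorem tsum_fiber_weight (k : ℕ) :
    ∑' t : BinaryTree.numNodes (α := Unit) ⁻¹' {k}, weight t
      = ENNReal.ofReal ((catalan k : ℝ) / 2 ^ (2 * k + 1)) := by
  have h : (BinaryTree.numNodes (α := Unit) ⁻¹' {k}) = BinaryTree.treesOfNumNodesEq k := by
    ext t
    simp
  rw [h]
  have h2 := Finset.tsum_subtype' (BinaryTree.treesOfNumNodesEq k) weight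
  rw [h2, Finset.sum_congr rfl (g := fun _ => ((2 : ℝ≥0∞) ^ (2 * k + 1))⁻¹), Finset.sum_const,
    BinaryTree.treesOfNumNodesEq_card_eq_catalan, nsmul_eq_mul,
    ENNReal.ofReal_div_of_pos (by positivity), ENNReal.ofReal_natCast,
    ENNReal.ofReal_pow zero_le_two, ENNReal.ofReal_ofNat, div_eq_mul_inv]
  intro t ht
  rw [weight, BinaryTree.mem_treesOfNumNodesEq.1 ht]

theorem tsum_weight : ∑' t, weight t = 1 := by
  rw [← ENNReal.tsum_fiberwise weight BinaryTree.numNodes]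
  simp_rw [tsum_fiber_weight]
  rw [← ENNReal.ofReal_tsum_of_nonneg (fun k => by positivity) hasSum_catalan.summable,
    hasSum_catalan.tsum_eq, ENNReal.ofReal_one]

theorem weight_ne_zero (t : BinaryTree Unit) : weight t ≠ 0 := by
  simp [weight]

theorem weight_node (a : Unit) (l r : BinaryTree Unit) :
    weight (.node a l r) = 2⁻¹ * (weight l * weight r) := by
  simp only [weight, BinaryTree.numNodes]
  rw [← ENNReal.mul_inv (by simp) (by simp), ← ENNReal.mul_inv (by simp) (by simp)]
  congr 1
  ring

/-- The law of the shape of a critical binary Galton-Watson tree. -/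
noncomputable def shapeLaw : PMF (BinaryTree Unit) :=
  ⟨weight, tsum_weight ▸ ENNReal.summable.hasSum⟩

end Weight

/-! ### The law of the number of surviving nodes -/

/-- The probability that `j` nodes send no mark on a given edge. -/
noncomputable def keep (n j : ℕ) : ℝ := 2 / (2 + (j : ℝ) / n)

theorem keep_pos (n j : ℕ) : 0 < keep n j := by unfold keep; positivity

theorem keep_le_one (n j : ℕ) : keep n j ≤ 1 := by
  unfold keep
  rw [div_le_one (by positivity)]
  linarith [show (0 : ℝ) ≤ (j : ℝ) / n by positivity]

/-- The law on `Bool` that gives probability `p` to `true`. -/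
noncomputable def coin (p : ℝ≥0∞) (h : p ≤ 1) : PMF Bool :=
  PMF.ofFintype (fun b => cond b p (1 - p)) (by simp [h])

/-- The law of the number of surviving nodes of a tree of shape `t`. -/
noncomputable def survivorLaw (n : ℕ) : BinaryTree Unit → PMF ℕ
  | .nil => PMF.pure 0
  | .node _ l r => (survivorLaw n l).bind fun a => (survivorLaw n r).bind fun b =>
      (coin (ENNReal.ofReal (keep n (a + b + 1))) (ENNReal.ofReal_le_one.2 (keep_le_one _ _))).bind
        fun s => PMF.pure (if s then a + b + 1 else 0)

/-- A positive number of survivors forces the edge to be uncut, and the root of the subtree then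
accounts for one of them. The value 0, which collects all the cut configurations, is never computed;
it is recovered from the total mass. -/
theorem survivorLaw_node_succ (n : ℕ) (a : Unit) (l r : BinaryTree Unit) (j : ℕ) :
    survivorLaw n (.node a l r) (j + 1) = ENNReal.ofReal (keep n (j + 1)) *
      ∑ p ∈ Finset.HasAntidiagonal.antidiagonal j, survivorLaw n l p.1 * survivorLaw n r p.2 := by
  have h : survivorLaw n (.node a l r) (j + 1) = ∑' p : ℕ × ℕ, survivorLaw n l p.1 *
      (survivorLaw n r p.2 * if p.1 + p.2 = j then ENNReal.ofReal (keep n (j + 1)) else 0) := by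
    rw [ENNReal.tsum_prod', survivorLaw, PMF.bind_apply]
    refine tsum_congr fun x => ?_
    rw [PMF.bind_apply, ← ENNReal.tsum_mul_left]
    refine tsum_congr fun y => ?_
    congr 2
    rw [PMF.bind_apply, tsum_bool]
    simp only [coin, PMF.ofFintype_apply, PMF.pure_apply]
    by_cases hxy : x + y = j
    · simp [hxy]
    · have : ¬ j = x + y := fun h => hxy h.symm
      simp [hxy, this]
  rw [h, tsum_eq_sum (s := Finset.HasAntidiagonal.antidiagonal j), Finset.mul_sum]
  · refine Finset.sum_congr rfl fun p hp => ?_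
    rw [if_pos (Finset.HasAntidiagonal.mem_antidiagonal.1 hp)]
    ring
  · intro p hp
    rw [if_neg (fun h => hp (Finset.HasAntidiagonal.mem_antidiagonal.2 h))]
    simp

theorem tsum_binaryTree (f : BinaryTree Unit → ℝ≥0∞) :
    ∑' t, f t = f .nil + ∑' p : BinaryTree Unit × BinaryTree Unit, f (.node () p.1 p.2) := by
  have hinj : Function.Injective fun p : BinaryTree Unit × BinaryTree Unit =>
      BinaryTree.node () p.1 p.2 := by
    rintro ⟨l, r⟩ ⟨l', r'⟩ h
    simpa using h
  have hrange : ({.nil} : Set (BinaryTree Unit))ᶜ =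
      Set.range fun p : BinaryTree Unit × BinaryTree Unit => BinaryTree.node () p.1 p.2 := by
    ext t
    cases t <;> simp
  rw [← ENNReal.summable.tsum_add_tsum_compl (s := {.nil}) ENNReal.summable, hrange,
    tsum_range f hinj, tsum_singleton]

/-- The law of the number of surviving nodes of a critical binary Galton-Watson tree. -/
noncomputable def prunedLaw (n : ℕ) : PMF ℕ := shapeLaw.bind (survivorLaw n)

theorem prunedLaw_apply (n j : ℕ) : prunedLaw n j = ∑' t, weight t * survivorLaw n t j :=
  PMF.bind_apply _ _ _

/-- The branching property: the factor `2⁻¹` is the probability that the root has children, and its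
two subtrees are independent copies. -/
theorem prunedLaw_succ (n j : ℕ) :
    prunedLaw n (j + 1) = 2⁻¹ * ENNReal.ofReal (keep n (j + 1)) *
      ∑ p ∈ Finset.HasAntidiagonal.antidiagonal j, prunedLaw n p.1 * prunedLaw n p.2 := by
  rw [prunedLaw_apply, tsum_binaryTree]
  have h0 : survivorLaw n .nil (j + 1) = 0 := by simp [survivorLaw]
  simp_rw [survivorLaw_node_succ, weight_node, h0, mul_zero, zero_add, prunedLaw_apply,
    ← ENNReal.tsum_mul_right, ← ENNReal.tsum_mul_left, ← ENNReal.tsum_prod (f := fun l r =>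
      weight l * survivorLaw n l _ * (weight r * survivorLaw n r _))]
  rw [← Summable.tsum_finsetSum fun _ _ => ENNReal.summable, ← ENNReal.tsum_mul_left]
  refine tsum_congr fun p => ?_
  simp_rw [Finset.mul_sum]
  refine Finset.sum_congr rfl fun x _ => ?_
  ring

/-! ### The equilibrium -/

/-- The law of the number of leaves of the pruned tree. -/
noncomputable def leafLaw (n k : ℕ) : ℝ := if k = 0 then 0 else (prunedLaw n (k - 1)).toReal

theorem leafLaw_zero (n : ℕ) : leafLaw n 0 = 0 := by simp [leafLaw]

theorem leafLaw_succ (n j : ℕ) : leafLaw n (j + 1) = (prunedLaw n j).toReal := by simp [leafLaw]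

theorem leafLaw_nonneg (n k : ℕ) : 0 ≤ leafLaw n k := by
  unfold leafLaw
  split_ifs <;> simp

theorem hasSum_leafLaw (n : ℕ) : HasSum (leafLaw n) 1 := by
  rw [← hasSum_nat_add_iff' 1]
  simp only [leafLaw_succ, Finset.range_one, Finset.sum_singleton, leafLaw_zero, sub_zero]
  have h := ENNReal.hasSum_toReal (f := prunedLaw n) (by rw [PMF.tsum_coe]; simp)
  rwa [← ENNReal.tsum_toReal_eq (fun j => PMF.apply_ne_top _ _), PMF.tsum_coe,
    ENNReal.toReal_one] at h

/-- The normalized balance equation. -/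
def IsBalanced (n : ℕ) (p : ℕ → ℝ) : Prop :=
  ∀ k : ℕ, 2 ≤ k →
    (2 + ((k : ℝ) - 1) / n) * p k = ∑ i ∈ Finset.Ico 1 k, p i * p (k - i)

theorem isBalanced_leafLaw (n : ℕ) : IsBalanced n (leafLaw n) := by
  intro k hk
  obtain ⟨j, rfl⟩ := Nat.exists_eq_add_of_le' hk
  have h1 : ∑ i ∈ Finset.Ico 1 (j + 2), leafLaw n i * leafLaw n (j + 2 - i)
      = ∑ p ∈ Finset.HasAntidiagonal.antidiagonal j, (prunedLaw n p.1).toReal * (prunedLaw n p.2).toReal := by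
    rw [Finset.sum_Ico_eq_sum_range, Finset.Nat.sum_antidiagonal_eq_sum_range_succ
      (f := fun a b => (prunedLaw n a).toReal * (prunedLaw n b).toReal)]
    refine Finset.sum_congr (by simp) fun i hi => ?_
    rw [Finset.mem_range] at hi
    rw [show j + 2 - (1 + i) = j - i + 1 by omega, add_comm 1 i, leafLaw_succ, leafLaw_succ]
  rw [h1, show j + 2 = j + 1 + 1 from rfl, leafLaw_succ, prunedLaw_succ, ENNReal.toReal_mul,
    ENNReal.toReal_mul, ENNReal.toReal_sum, ENNReal.toReal_ofReal (keep_pos _ _).le]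
  · simp_rw [ENNReal.toReal_mul]
    have : (0 : ℝ) < 2 + ((j + 1 : ℕ) : ℝ) / n := by positivity
    rw [keep, ← mul_assoc]
    -- What remains is `(2 + (j + 1) / n) * (1 / 2) * keep n (j + 1) = 1`.
    convert one_mul _ using 2
    push_cast at this ⊢
    rw [add_sub_cancel_right]
    simp only [ENNReal.toReal_inv, ENNReal.toReal_ofNat]
    field_simp
  · exact fun p _ => ENNReal.mul_ne_top (PMF.apply_ne_top _ _) (PMF.apply_ne_top _ _)

/-- The right-hand side of the balance equation at `k` involves only entries of index below `k`, and
is increasing in them when they are nonnegative. -/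
theorem IsBalanced.le_of_le {n : ℕ} {p q : ℕ → ℝ} (hp : IsBalanced n p) (hq : IsBalanced n q)
    (hp0 : ∀ k, 0 ≤ p k) (hq0 : ∀ k, 0 ≤ q k) (h0 : p 0 = q 0) (h1 : p 1 ≤ q 1) (k : ℕ) :
    p k ≤ q k := by
  induction k using Nat.strong_induction_on with
  | _ k ih =>
    rcases Nat.lt_or_ge k 2 with hk | hk
    · interval_cases k
      · exact h0.le
      · exact h1
    · have hc : 0 < 2 + ((k : ℝ) - 1) / n := by
        have : (1 : ℝ) ≤ k := by exact_mod_cast (by omega : 1 ≤ k)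
        have : 0 ≤ ((k : ℝ) - 1) / n := div_nonneg (by linarith) (Nat.cast_nonneg n)
        linarith
      refine le_of_mul_le_mul_left ?_ hc
      rw [hp k hk, hq k hk]
      refine Finset.sum_le_sum fun i hi => ?_
      rw [Finset.mem_Ico] at hi
      exact mul_le_mul (ih i hi.2) (ih _ (by omega)) (hp0 _) (hq0 _)

/-- Two solutions are ordered entrywise according to their first entries; having equal sums, they
coincide. -/
theorem IsBalanced.unique {n : ℕ} {p q : ℕ → ℝ} (hp : IsBalanced n p) (hq : IsBalanced n q)
    (hp0 : ∀ k, 0 ≤ p k) (hq0 : ∀ k, 0 ≤ q k) (h0 : p 0 = q 0) {s : ℝ} (hps : HasSum p s)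
    (hqs : HasSum q s) : p = q := by
  have key : ∀ {p q : ℕ → ℝ}, HasSum p s → HasSum q s → (∀ k, p k ≤ q k) → p = q := by
    intro p q hps hqs h
    have h2 := hqs.sub hps
    rw [sub_self, hasSum_zero_iff_of_nonneg fun k => sub_nonneg.2 (h k)] at h2
    funext k
    exact (sub_eq_zero.1 (congrFun h2 k)).symm
  rcases le_total (p 1) (q 1) with h1 | h1
  · exact key hps hqs (hp.le_of_le hq hp0 hq0 h0 h1)
  · exact (key hqs hps (hq.le_of_le hp hq0 hp0 h0.symm h1)).symm

/-- Multiplied by `n`, the balance equation bounds `k * p k` by `n` times the convolution square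
plus `p k`, and both are summable. -/
theorem IsBalanced.summable_mul {n : ℕ} (hn : 1 ≤ n) {p : ℕ → ℝ} (hp : IsBalanced n p)
    (hp0 : ∀ k, 0 ≤ p k) (hs : Summable p) : Summable fun k : ℕ => (k : ℝ) * p k := by
  have hconv : Summable fun k => ∑ x ∈ Finset.HasAntidiagonal.antidiagonal k, p x.1 * p x.2 :=
    summable_sum_mul_antidiagonal_of_summable_mul (hs.mul_of_nonneg hs hp0 hp0)
  refine Summable.of_nonneg_of_le (fun k => mul_nonneg (Nat.cast_nonneg k) (hp0 k)) (fun k => ?_)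
    ((hconv.mul_left (n : ℝ)).add hs)
  have hn' : (0 : ℝ) < n := by exact_mod_cast hn
  have hnn : 0 ≤ ∑ x ∈ Finset.HasAntidiagonal.antidiagonal k, p x.1 * p x.2 :=
    Finset.sum_nonneg fun x _ => mul_nonneg (hp0 _) (hp0 _)
  rcases Nat.lt_or_ge k 2 with hk | hk
  · have : (k : ℝ) * p k ≤ 1 * p k :=
      mul_le_mul_of_nonneg_right (by exact_mod_cast (by omega : k ≤ 1)) (hp0 k)
    nlinarith [mul_nonneg hn'.le hnn]
  · have h1 : ∑ i ∈ Finset.Ico 1 k, p i * p (k - i)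
        ≤ ∑ x ∈ Finset.HasAntidiagonal.antidiagonal k, p x.1 * p x.2 := by
      rw [Finset.Nat.sum_antidiagonal_eq_sum_range_succ (f := fun a b => p a * p b)]
      refine Finset.sum_le_sum_of_subset_of_nonneg (fun i hi => ?_) fun i _ _ =>
        mul_nonneg (hp0 _) (hp0 _)
      simp only [Finset.mem_Ico, Finset.mem_range] at hi ⊢
      omega
    rw [← hp k hk] at h1
    have h2 := mul_le_mul_of_nonneg_left h1 hn'.le
    have h3 : (n : ℝ) * ((2 + ((k : ℝ) - 1) / n) * p k) = 2 * n * p k + k * p k - p k := by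
      field_simp
      ring
    have := mul_nonneg hn'.le (hp0 k)
    linarith

/-! ### Equilibria and their normalization. -/

theorem moment_zero_eq {c : ℕ → ℝ} : moment 0 c = ∑' k, c k := by
  simp [moment]

theorem IsEquilibrium.summable {n : ℕ} {c : ℕ → ℝ} (hc : IsEquilibrium n c) : Summable c := by
  refine Summable.of_nonneg_of_le hc.nonneg (fun k => ?_) hc.mass.summable
  rcases Nat.eq_zero_or_pos k with rfl | hk
  · simp [hc.zero]
  · have : (1 : ℝ) ≤ k := by exact_mod_cast hk
    nlinarith [hc.nonneg k]

theorem IsEquilibrium.moment_zero_pos {n : ℕ} {c : ℕ → ℝ} (hc : IsEquilibrium n c) :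
    0 < moment 0 c := by
  rw [moment_zero_eq]
  refine lt_of_le_of_ne (tsum_nonneg hc.nonneg) fun h => ?_
  have h0 := hc.summable.hasSum
  rw [← h, hasSum_zero_iff_of_nonneg hc.nonneg] at h0
  have := hc.mass
  simp only [h0, Pi.zero_apply, mul_zero] at this
  exact zero_ne_one (hasSum_zero.unique this)

theorem IsEquilibrium.div_moment_eq {n : ℕ} {c : ℕ → ℝ} (hc : IsEquilibrium n c) (k : ℕ) :
    c k / moment 0 c = leafLaw n k := by
  have hm := hc.moment_zero_pos
  have hbal : IsBalanced n fun k => c k / moment 0 c := by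
    intro k hk
    have : ∑ i ∈ Finset.Ico 1 k, c i / moment 0 c * (c (k - i) / moment 0 c)
        = (∑ i ∈ Finset.Ico 1 k, c i * c (k - i)) / (moment 0 c * moment 0 c) := by
      simp_rw [div_mul_div_comm, Finset.sum_div]
    rw [this, ← mul_div_assoc, hc.balance k hk]
    field_simp
  refine congrFun (hbal.unique (isBalanced_leafLaw n)
    (fun k => div_nonneg (hc.nonneg k) hm.le) (leafLaw_nonneg n) ?_ ?_ (hasSum_leafLaw n)) k
  · simp [hc.zero, leafLaw_zero]
  · have := hc.summable.hasSum.div_const (moment 0 c)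
    rwa [← moment_zero_eq, div_self hm.ne'] at this

theorem exists_isEquilibrium {n : ℕ} (hn : 1 ≤ n) : ∃ c, IsEquilibrium n c := by
  have hs := (isBalanced_leafLaw n).summable_mul hn (leafLaw_nonneg n) (hasSum_leafLaw n).summable
  set E := ∑' k : ℕ, (k : ℝ) * leafLaw n k with hE
  have hE1 : 1 ≤ E := by
    rw [hE, ← (hasSum_leafLaw n).tsum_eq]
    refine (hasSum_leafLaw n).summable.tsum_le_tsum (fun k => ?_) hs
    rcases Nat.eq_zero_or_pos k with rfl | hk
    · simp [leafLaw_zero]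
    · have : (1 : ℝ) ≤ k := by exact_mod_cast hk
      nlinarith [leafLaw_nonneg n k]
  have hE0 : 0 < E := by linarith
  have hm : moment 0 (fun k => leafLaw n k / E) = 1 / E := by
    rw [moment_zero_eq, tsum_div_const, (hasSum_leafLaw n).tsum_eq]
  refine ⟨fun k => leafLaw n k / E, by simp [leafLaw_zero],
    fun k => div_nonneg (leafLaw_nonneg n k) hE0.le, ?_, fun k hk => ?_⟩
  · have := hs.hasSum.div_const E
    rw [← hE, div_self hE0.ne'] at this
    simpa only [mul_div_assoc] using this
  · have : ∑ i ∈ Finset.Ico 1 k, leafLaw n i / E * (leafLaw n (k - i) / E)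
        = (∑ i ∈ Finset.Ico 1 k, leafLaw n i * leafLaw n (k - i)) / (E * E) := by
      simp_rw [div_mul_div_comm, Finset.sum_div]
    rw [hm, this, ← mul_div_assoc, isBalanced_leafLaw n k hk]
    field_simp

/-- Equal normalizations make two equilibria proportional, and the mass condition forces the factor
to be 1. -/
theorem IsEquilibrium.unique {n : ℕ} {c c' : ℕ → ℝ} (hc : IsEquilibrium n c)
    (hc' : IsEquilibrium n c') : c' = c := by
  have hm := hc.moment_zero_pos
  have hm' := hc'.moment_zero_pos
  have h : ∀ k, c' k = moment 0 c' / moment 0 c * c k := fun k => by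
    have := (hc'.div_moment_eq k).trans (hc.div_moment_eq k).symm
    field_simp at this ⊢
    linarith
  have h1 : moment 0 c' / moment 0 c = 1 := by
    have h2 := hc.mass.mul_left (moment 0 c' / moment 0 c)
    have h3 := hc'.mass
    simp only [h] at h3
    rw [mul_one] at h2
    refine h2.unique ?_
    simpa only [mul_left_comm] using h3
  funext k
  rw [h, h1, one_mul]

/-! ### The number of surviving nodes when the marks on different edges are independent -/

section SurvivorLaw

variable {Ω : Type*} {Z : Ω → List ℕ → List ℕ → Prop} {I : Finset (List ℕ)}

/-- No node of `S` sends a mark on the edge with upper end `v`. -/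
def noMarks (Z : Ω → List ℕ → List ℕ → Prop) (v : List ℕ) (S : Finset (List ℕ)) : Set Ω :=
  {ω | ∀ x ∈ S, Z ω x v}

/-- The events that some given nodes of `I` above `v` send no mark on the edge with upper
end `v`. -/
def noMarksSets (Z : Ω → List ℕ → List ℕ → Prop) (I : Finset (List ℕ)) (v : List ℕ) :
    Set (Set Ω) :=
  {A | ∃ S : Finset (List ℕ), (S ⊆ I ∧ ∀ x ∈ S, v <+: x) ∧ A = noMarks Z v S}

theorem isPiSystem_noMarksSets (v : List ℕ) : IsPiSystem (noMarksSets Z I v) := by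
  rintro _ ⟨S, hS, rfl⟩ _ ⟨S', hS', rfl⟩ -
  refine ⟨S ∪ S', ⟨Finset.union_subset hS.1 hS'.1, fun x hx => ?_⟩, ?_⟩
  · rcases Finset.mem_union.1 hx with h | h
    · exact hS.2 x h
    · exact hS'.2 x h
  · ext ω
    simp only [noMarks, Set.mem_inter_iff, Set.mem_ofPred_eq, Finset.mem_union]
    exact ⟨fun h x => Or.rec (h.1 x) (h.2 x), fun h =>
      ⟨fun x hx => h x (Or.inl hx), fun x hx => h x (Or.inr hx)⟩⟩

/-- The information on the marks on the edges in `E`. -/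
abbrev marksOn (Z : Ω → List ℕ → List ℕ → Prop) (I : Finset (List ℕ)) (E : Set (List ℕ)) :
    MeasurableSpace Ω :=
  ⨆ u ∈ E, MeasurableSpace.generateFrom (noMarksSets Z I u)

theorem marksOn_mono {E E' : Set (List ℕ)} (h : E ⊆ E') : marksOn Z I E ≤ marksOn Z I E' :=
  biSup_mono h

theorem measurableSet_noMarks {E : Set (List ℕ)} {v : List ℕ} (hv : v ∈ E)
    {S : Finset (List ℕ)} (hS : S ⊆ I) (hS' : ∀ x ∈ S, v <+: x) :
    MeasurableSet[marksOn Z I E] (noMarks Z v S) :=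
  le_biSup (fun u => MeasurableSpace.generateFrom (noMarksSets Z I u)) hv _
    (MeasurableSpace.measurableSet_generateFrom ⟨S, ⟨hS, hS'⟩, rfl⟩)

theorem prefix_of_mem_insert_union {l r : BinaryTree Unit} {v x : List ℕ}
    {A B : Finset (List ℕ)} (hA : A ⊆ innerVertices l (v ++ [0]))
    (hB : B ⊆ innerVertices r (v ++ [1])) (hx : x ∈ insert v (A ∪ B)) : v <+: x := by
  simp only [Finset.mem_insert, Finset.mem_union] at hx
  rcases hx with rfl | hx | hx
  · exact List.prefix_refl _
  · exact (List.prefix_append _ _).trans (prefix_of_mem_innerVertices (hA hx))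
  · exact (List.prefix_append _ _).trans (prefix_of_mem_innerVertices (hB hx))

/-- Survival above `v` is decided by the marks on the edges whose upper end is `v` or lies above it.
The event is split over the finitely many possible survivor sets of the two child subtrees. -/
theorem measurableSet_survivors_eq {t : BinaryTree Unit} {v : List ℕ}
    (ht : innerVertices t v ⊆ I) (D : Finset (List ℕ)) :
    MeasurableSet[marksOn Z I {u | v <+: u}] {ω | survivors (Z ω) t v = D} := by
  induction t generalizing v D with
  | nil => exact @MeasurableSet.const _ (marksOn Z I {u | v <+: u}) (∅ = D)
  | node a l r hl hr =>
    have hl' : innerVertices l (v ++ [0]) ⊆ I := fun x hx => ht (mem_left_iff.1 hx).1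
    have hr' : innerVertices r (v ++ [1]) ⊆ I := fun x hx => ht (mem_right_iff.1 hx).1
    have hsub : ∀ i, {u | v ++ [i] <+: u} ⊆ {u | v <+: u} := fun i u hu =>
      (List.prefix_append _ _).trans hu
    have h : {ω | survivors (Z ω) (.node a l r) v = D} =
      ⋃ p ∈ (innerVertices l (v ++ [0])).powerset ×ˢ (innerVertices r (v ++ [1])).powerset,
        ({ω | survivors (Z ω) l (v ++ [0]) = p.1} ∩ {ω | survivors (Z ω) r (v ++ [1]) = p.2}) ∩
          (noMarks Z v (insert v (p.1 ∪ p.2)) ∩ {_ω | insert v (p.1 ∪ p.2) = D} ∪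
            (noMarks Z v (insert v (p.1 ∪ p.2)))ᶜ ∩ {_ω | ∅ = D}) := by
      ext ω
      simp only [Set.mem_iUnion, Finset.mem_product, Finset.mem_powerset, Set.mem_inter_iff,
        Set.mem_ofPred_eq, Set.mem_union, Set.mem_compl_iff, exists_prop, survivors]
      constructor
      · intro h
        refine ⟨(survivors (Z ω) l (v ++ [0]), survivors (Z ω) r (v ++ [1])),
          ⟨survivors_subset, survivors_subset⟩, ⟨rfl, rfl⟩, ?_⟩
        split_ifs at h with hc
        · exact Or.inl ⟨hc, h⟩
        · exact Or.inr ⟨hc, h⟩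
      · rintro ⟨⟨A, B⟩, -, ⟨rfl, rfl⟩, ⟨hc, h⟩ | ⟨hc, h⟩⟩
        · exact (if_pos hc).trans h
        · exact (if_neg hc).trans h
    rw [h]
    refine Finset.measurableSet_biUnion _ fun p hp => ?_
    rw [Finset.mem_product, Finset.mem_powerset, Finset.mem_powerset] at hp
    have hno : MeasurableSet[marksOn Z I {u | v <+: u}]
        (noMarks Z v (insert v (p.1 ∪ p.2))) := by
      refine measurableSet_noMarks (List.prefix_refl v)
        (((Finset.insert_subset_insert _ (Finset.union_subset_union hp.1 hp.2))).trans ht)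
        fun x => prefix_of_mem_insert_union hp.1 hp.2
    refine MeasurableSet.inter (MeasurableSet.inter ?_ ?_) (MeasurableSet.union ?_ ?_)
    · exact marksOn_mono (hsub 0) _ (hl hl' p.1)
    · exact marksOn_mono (hsub 1) _ (hr hr' p.2)
    · exact hno.inter (.const _)
    · exact hno.compl.inter (.const _)

variable [MeasurableSpace Ω] {μ : Measure Ω} {n : ℕ}

theorem iIndep_generateFrom_noMarksSets
    (hmeas : ∀ v S, S ⊆ I → MeasurableSet (noMarks Z v S))
    (hlaw : ∀ (V : Finset (List ℕ)) (S : List ℕ → Finset (List ℕ)),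
      (∀ v ∈ V, S v ⊆ I ∧ ∀ x ∈ S v, v <+: x) →
      μ (⋂ v ∈ V, noMarks Z v (S v)) = ∏ v ∈ V, ENNReal.ofReal (keep n (S v).card)) :
    iIndep (fun u => MeasurableSpace.generateFrom (noMarksSets Z I u)) μ := by
  refine iIndepSets.iIndep (fun u => MeasurableSpace.generateFrom_le ?_) (noMarksSets Z I)
    (fun v => isPiSystem_noMarksSets v) (fun _ => rfl) ?_
  · rintro _ ⟨S, hS, rfl⟩
    exact hmeas u S hS.1
  · rw [iIndepSets_iff]
    intro V f hf
    choose! S hS using hf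
    have h1 : ⋂ v ∈ V, f v = ⋂ v ∈ V, noMarks Z v (S v) :=
      Set.iInter₂_congr fun v hv => (hS v hv).2
    rw [h1, hlaw V S fun v hv => (hS v hv).1]
    refine Finset.prod_congr rfl fun v hv => ?_
    -- The product formula for one edge gives the marginal probabilities.
    have := hlaw {v} S fun w hw => by
      rw [Finset.mem_singleton.1 hw]
      exact (hS v hv).1
    rw [(hS v hv).2]
    simpa using this.symm

/-- The edges of the left subtree, those of the right subtree and the edge below `v` form three
disjoint, hence independent, families. Once the survivor sets of the subtrees are fixed, the set of
nodes that must send no mark below `v` is deterministic, so its probability enters as a factor. -/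
theorem measure_card_survivors [IsProbabilityMeasure μ]
    (hmeas : ∀ v S, S ⊆ I → MeasurableSet (noMarks Z v S))
    (hlaw : ∀ (V : Finset (List ℕ)) (S : List ℕ → Finset (List ℕ)),
      (∀ v ∈ V, S v ⊆ I ∧ ∀ x ∈ S v, v <+: x) →
      μ (⋂ v ∈ V, noMarks Z v (S v)) = ∏ v ∈ V, ENNReal.ofReal (keep n (S v).card))
    {t : BinaryTree Unit} {v : List ℕ} (ht : innerVertices t v ⊆ I) (j : ℕ) :
    μ {ω | (survivors (Z ω) t v).card = j} = survivorLaw n t j := by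
  have hle : ∀ u, MeasurableSpace.generateFrom (noMarksSets Z I u) ≤ ‹MeasurableSpace Ω› := by
    refine fun u => MeasurableSpace.generateFrom_le ?_
    rintro _ ⟨S, hS, rfl⟩
    exact hmeas u S hS.1
  have hind := iIndep_generateFrom_noMarksSets hmeas hlaw
  have hms : ∀ {t : BinaryTree Unit} {v : List ℕ}, innerVertices t v ⊆ I → ∀ D,
      MeasurableSet {ω | survivors (Z ω) t v = D} := fun ht D =>
    (iSup₂_le fun u _ => hle u : marksOn Z I _ ≤ _) _ (measurableSet_survivors_eq ht D)
  have hcard : ∀ {t : BinaryTree Unit} {v : List ℕ} j,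
      {ω | (survivors (Z ω) t v).card = j} =
        ⋃ D ∈ (innerVertices t v).powersetCard j, {ω | survivors (Z ω) t v = D} := by
    intro t v j
    ext ω
    simp only [Set.mem_ofPred_eq, Set.mem_iUnion, Finset.mem_powersetCard, exists_prop]
    exact ⟨fun h => ⟨_, ⟨survivors_subset, h⟩, rfl⟩, by rintro ⟨D, ⟨-, h⟩, rfl⟩; exact h⟩
  have hmcard : ∀ {t : BinaryTree Unit} {v : List ℕ}, innerVertices t v ⊆ I → ∀ j,
      μ {ω | (survivors (Z ω) t v).card = j} =
        ∑ D ∈ (innerVertices t v).powersetCard j, μ {ω | survivors (Z ω) t v = D} := by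
    intro t v ht j
    rw [hcard, measure_biUnion_finset]
    · intro D _ D' _ hne
      exact Set.disjoint_left.2 fun ω h h' => hne (h.symm.trans h')
    · exact fun D _ => hms ht D
  induction t generalizing v j with
  | nil => cases j <;> simp [survivors, survivorLaw]
  | node a l r hl hr =>
    have hl' : innerVertices l (v ++ [0]) ⊆ I := fun x hx => ht (mem_left_iff.1 hx).1
    have hr' : innerVertices r (v ++ [1]) ⊆ I := fun x hx => ht (mem_right_iff.1 hx).1
    have hsucc : ∀ j, μ {ω | (survivors (Z ω) (.node a l r) v).card = j + 1}
        = survivorLaw n (.node a l r) (j + 1) := by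
      intro j
      have hset : {ω | (survivors (Z ω) (.node a l r) v).card = j + 1} =
          ⋃ p ∈ ((innerVertices l (v ++ [0])).powerset ×ˢ
            (innerVertices r (v ++ [1])).powerset).filter fun p => p.1.card + p.2.card = j,
            ({ω | survivors (Z ω) l (v ++ [0]) = p.1} ∩
              {ω | survivors (Z ω) r (v ++ [1]) = p.2}) ∩
              noMarks Z v (insert v (p.1 ∪ p.2)) := by
        ext ω
        simp only [Set.mem_iUnion, Finset.mem_filter, Finset.mem_product, Finset.mem_powerset,
          Set.mem_inter_iff, Set.mem_ofPred_eq, exists_prop, survivors]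
        constructor
        · intro h
          split_ifs at h with hc
          · rw [card_insert_union_of_subset survivors_subset survivors_subset] at h
            exact ⟨(survivors (Z ω) l (v ++ [0]), survivors (Z ω) r (v ++ [1])),
              ⟨⟨survivors_subset, survivors_subset⟩, by simpa using h⟩, ⟨rfl, rfl⟩, hc⟩
          · simp at h
        · rintro ⟨⟨A, B⟩, ⟨-, h⟩, ⟨rfl, rfl⟩, hc⟩
          have hc' : ∀ x ∈ insert v (survivors (Z ω) l (v ++ [0]) ∪ survivors (Z ω) r (v ++ [1])),
            Z ω x v := hc
          rw [if_pos hc', card_insert_union_of_subset survivors_subset survivors_subset, h]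
      have hE : ∀ p ∈ ((innerVertices l (v ++ [0])).powerset ×ˢ
            (innerVertices r (v ++ [1])).powerset).filter fun p => p.1.card + p.2.card = j,
          μ (({ω | survivors (Z ω) l (v ++ [0]) = p.1} ∩
              {ω | survivors (Z ω) r (v ++ [1]) = p.2}) ∩
              noMarks Z v (insert v (p.1 ∪ p.2))) =
            ENNReal.ofReal (keep n (j + 1)) * (μ {ω | survivors (Z ω) l (v ++ [0]) = p.1} *
              μ {ω | survivors (Z ω) r (v ++ [1]) = p.2}) := by
        intro p hp
        rw [Finset.mem_filter, Finset.mem_product, Finset.mem_powerset,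
          Finset.mem_powerset] at hp
        obtain ⟨⟨hpl, hpr⟩, hpj⟩ := hp
        have hsubI : insert v (p.1 ∪ p.2) ⊆ I :=
          ((Finset.insert_subset_insert _ (Finset.union_subset_union hpl hpr))).trans ht
        have hpre : ∀ x ∈ insert v (p.1 ∪ p.2), v <+: x := fun x =>
          prefix_of_mem_insert_union hpl hpr
        have hd1 : Disjoint {u : List ℕ | v ++ [0] <+: u} {u | v ++ [1] <+: u} :=
          Set.disjoint_left.2 fun u h0 h1 => zero_ne_one (eq_of_child_prefix h0 h1)
        have hd2 : Disjoint ({u : List ℕ | v ++ [0] <+: u} ∪ {u | v ++ [1] <+: u}) {v} := by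
          rw [Set.disjoint_singleton_right]
          rintro (h | h) <;> exact not_child_prefix_self _ h
        have hA := measurableSet_survivors_eq (Z := Z) hl' p.1
        have hB := measurableSet_survivors_eq (Z := Z) hr' p.2
        have i1 := (Indep_iff _ _ _).1 (indep_iSup_of_disjoint hle hind hd1) _ _ hA hB
        have i2 := (Indep_iff _ _ _).1 (indep_iSup_of_disjoint hle hind hd2) _ _
          (MeasurableSet.inter (marksOn_mono Set.subset_union_left _ hA)
            (marksOn_mono Set.subset_union_right _ hB))
          (measurableSet_noMarks (Set.mem_singleton v) hsubI hpre)
        have hk : μ (noMarks Z v (insert v (p.1 ∪ p.2))) = ENNReal.ofReal (keep n (j + 1)) := by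
          have := hlaw {v} (fun _ => insert v (p.1 ∪ p.2)) fun w hw => by
            rw [Finset.mem_singleton.1 hw]
            exact ⟨hsubI, hpre⟩
          simpa [card_insert_union_of_subset hpl hpr, hpj] using this
        rw [i2, i1, hk, mul_comm]
      rw [hset, measure_biUnion_finset, Finset.sum_congr rfl hE, survivorLaw_node_succ,
        ← Finset.mul_sum]
      · congr 1
        -- Pairs of survivor sets are grouped by their cardinalities, which turns the sum into a
        -- convolution.
        rw [← Finset.sum_fiberwise_of_maps_to
          (t := Finset.HasAntidiagonal.antidiagonal j) (g := fun p => (p.1.card, p.2.card))]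
        · refine Finset.sum_congr rfl fun ab hab => ?_
          rw [← hl hl', ← hr hr', hmcard hl', hmcard hr', Finset.sum_mul_sum,
            ← Finset.sum_product']
          refine Finset.sum_congr ?_ fun _ _ => rfl
          ext p
          rw [Finset.HasAntidiagonal.mem_antidiagonal] at hab
          simp only [Finset.mem_filter, Finset.mem_product, Finset.mem_powerset,
            Finset.mem_powersetCard, Prod.ext_iff]
          constructor
          · tauto
          · rintro ⟨⟨h1, h2⟩, h3, h4⟩
            exact ⟨⟨⟨h1, h3⟩, by omega⟩, h2, h4⟩
        · intro p hp
          exact Finset.HasAntidiagonal.mem_antidiagonal.2 (Finset.mem_filter.1 hp).2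
      · intro p _ q _ hne
        refine Set.disjoint_left.2 fun ω h h' => hne (Prod.ext ?_ ?_)
        · exact h.1.1.symm.trans h'.1.1
        · exact h.1.2.symm.trans h'.1.2
      · intro p hp
        rw [Finset.mem_filter, Finset.mem_product, Finset.mem_powerset,
          Finset.mem_powerset] at hp
        exact ((hms hl' _).inter (hms hr' _)).inter (hmeas _ _
          ((Finset.insert_subset_insert _ (Finset.union_subset_union hp.1.1 hp.1.2)).trans ht))
    cases j with
    | succ j => exact hsucc j
    | zero =>
      -- Both laws have total mass 1 and agree at all positive values, hence also at 0.
      have h1 : ∑' j, μ {ω | (survivors (Z ω) (.node a l r) v).card = j} = 1 := by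
        rw [← measure_iUnion]
        · rw [← measure_univ (μ := μ)]
          congr 1
          ext ω
          simp
        · intro i j hij
          exact Set.disjoint_left.2 fun ω h h' => hij (h.symm.trans h')
        · intro j
          rw [hcard]
          exact Finset.measurableSet_biUnion _ fun D _ => hms ht D
      have h2 := (survivorLaw n (.node a l r)).tsum_coe
      rw [tsum_eq_zero_add' ENNReal.summable] at h1 h2
      simp_rw [hsucc] at h1
      refine (ENNReal.add_left_inj ?_).1 (h1.trans h2.symm)
      exact ne_top_of_le_ne_top ENNReal.one_ne_top (h2 ▸ le_add_self)

end SurvivorLaw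

/-! ### The shape of the Galton-Watson tree -/

instance : Countable (BinaryTree Unit) :=
  Function.Injective.countable (f := fun t => vertices t []) fun _ _ h => vertices_injective h

section Shape

variable {Ω : Type*} {ξ : List ℕ → Ω → ℕ}

theorem offspringLaw_zero : offspringLaw {0} = 2⁻¹ := by
  simp [offspringLaw]

theorem offspringLaw_two : offspringLaw {2} = 2⁻¹ := by
  simp [offspringLaw]

theorem card_vertices (t : BinaryTree Unit) (v : List ℕ) :
    (vertices t v).card = 2 * t.numNodes + 1 := by
  rw [← inner_union_outer, Finset.card_union_of_disjoint disjoint_inner_outer,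
    card_innerVertices, card_outerVertices, BinaryTree.numLeaves_eq_numNodes_succ]
  ring

/-- The event that the tree has the shape `t`. -/
def shapeEvent (ξ : List ℕ → Ω → ℕ) (t : BinaryTree Unit) : Set Ω :=
  {ω | treeOf (fun v => ξ v ω) = vertices t []}

open Classical in
theorem shapeEvent_eq_iInter (t : BinaryTree Unit) :
    shapeEvent ξ t = ⋂ x ∈ vertices t [],
      ξ x ⁻¹' {if x ∈ innerVertices t [] then 2 else 0} := by
  ext ω
  simp only [shapeEvent, Set.mem_ofPred_eq, treeOf_eq_vertices_iff, Set.mem_iInter,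
    Set.mem_preimage, Set.mem_singleton_iff]
  constructor
  · rintro ⟨h1, h2⟩ x hx
    split_ifs with h
    · exact h1 x h
    · rw [← inner_union_outer, Finset.mem_union] at hx
      exact h2 x (hx.resolve_left h)
  · intro h
    refine ⟨fun x hx => ?_, fun x hx => ?_⟩
    · rw [h x (innerVertices_subset hx), if_pos hx]
    · rw [h x (outerVertices_subset hx), if_neg]
      exact fun h => Finset.disjoint_left.1 disjoint_inner_outer h hx

theorem pairwise_disjoint_shapeEvent :
    Pairwise (Function.onFun Disjoint (shapeEvent ξ)) := fun _ _ hne =>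
  Set.disjoint_left.2 fun _ h h' =>
    hne (vertices_injective (Finset.coe_injective (h.symm.trans h')))

variable [MeasurableSpace Ω] {P : Measure Ω}

theorem measure_shapeEvent (hξ : IsCriticalBinaryGW P ξ) (t : BinaryTree Unit) :
    P (shapeEvent ξ t) = weight t := by
  classical
  rw [shapeEvent_eq_iInter, hξ.indep.measure_inter_preimage_eq_mul _
    fun x _ => measurableSet_singleton _, Finset.prod_congr rfl (g := fun _ => (2 : ℝ≥0∞)⁻¹),
    Finset.prod_const, card_vertices, weight, ENNReal.inv_pow]
  intro x _
  rw [← Measure.map_apply (hξ.measurable x) (measurableSet_singleton _), hξ.law]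
  split_ifs
  · exact offspringLaw_two
  · exact offspringLaw_zero

theorem measurableSet_shapeEvent (hξ : IsCriticalBinaryGW P ξ) (t : BinaryTree Unit) :
    MeasurableSet (shapeEvent ξ t) := by
  classical
  rw [shapeEvent_eq_iInter]
  exact Finset.measurableSet_biInter _ fun x _ => hξ.measurable x (measurableSet_singleton _)

theorem ae_exists_shape [IsProbabilityMeasure P] (hξ : IsCriticalBinaryGW P ξ) :
    ∀ᵐ ω ∂P, ∃ t, ω ∈ shapeEvent ξ t := by
  have h : P (⋃ t, shapeEvent ξ t) = 1 := by
    rw [measure_iUnion pairwise_disjoint_shapeEvent (measurableSet_shapeEvent hξ)]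
    simp_rw [measure_shapeEvent hξ, tsum_weight]
  rw [← prob_compl_eq_zero_iff (MeasurableSet.iUnion (measurableSet_shapeEvent hξ))] at h
  filter_upwards [compl_mem_ae_iff.2 h] with ω hω
  simpa using hω

/-- `A` may be arbitrary because the shape events are measurable and countably many. Thus no
measurability of the pruned tree has to be proved. -/
theorem measure_eq_tsum_shape [IsProbabilityMeasure P] (hξ : IsCriticalBinaryGW P ξ)
    (A : Set Ω) : P A = ∑' t, P (A ∩ shapeEvent ξ t) := by
  have h : P.restrict (⋃ t, shapeEvent ξ t) = P := by
    rw [Measure.restrict_eq_self_of_ae_mem]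
    filter_upwards [ae_exists_shape hξ] with ω hω
    simpa using hω
  conv_lhs => rw [← h, Measure.restrict_iUnion pairwise_disjoint_shapeEvent
    (measurableSet_shapeEvent hξ), Measure.sum_apply_of_countable]
  exact tsum_congr fun t => Measure.restrict_apply' (measurableSet_shapeEvent hξ t)

theorem measure_encard_leaves [IsProbabilityMeasure P] (hξ : IsCriticalBinaryGW P ξ) {k : ℕ}
    (hk : 1 ≤ k) :
    P.real {ω | (leaves (treeOf fun v => ξ v ω)).encard = (k : ℕ∞)} = criticalLaw k := by
  obtain ⟨j, rfl⟩ := Nat.exists_eq_add_of_le' hk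
  have h : ∀ t, P ({ω | (leaves (treeOf fun v => ξ v ω)).encard = ((j + 1 : ℕ) : ℕ∞)} ∩
      shapeEvent ξ t) = (BinaryTree.numNodes (α := Unit) ⁻¹' {j}).indicator weight t := by
    intro t
    have hl : ∀ ω ∈ shapeEvent ξ t,
        (leaves (treeOf fun v => ξ v ω)).encard = ((t.numNodes + 1 : ℕ) : ℕ∞) := by
      intro ω hω
      rw [show treeOf (fun v => ξ v ω) = vertices t [] from hω, leaves_vertices,
        Set.encard_coe_eq_coe_finsetCard, card_outerVertices,
        BinaryTree.numLeaves_eq_numNodes_succ]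
    by_cases ht : t.numNodes = j
    · rw [Set.indicator_of_mem (by exact ht), ← measure_shapeEvent hξ]
      congr 1
      refine Set.inter_eq_right.2 fun ω hω => ?_
      rw [Set.mem_ofPred_eq, hl ω hω, ht]
    · rw [Set.indicator_of_notMem (by exact ht), ← measure_empty (μ := P)]
      congr 1
      refine Set.eq_empty_of_forall_notMem fun ω ⟨h1, h2⟩ => ht ?_
      rw [Set.mem_ofPred_eq, hl ω h2] at h1
      have := Nat.cast_injective h1
      omega
  rw [measureReal_def, measure_eq_tsum_shape hξ]
  simp_rw [h]
  rw [← tsum_subtype, tsum_fiber_weight, ENNReal.toReal_ofReal (by positivity), criticalLaw]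
  have h1 : ((j : ℝ) + 1) * catalan j = j.centralBinom := by
    exact_mod_cast succ_mul_catalan_eq_centralBinom j
  rw [show 2 * (j + 1) - 2 = 2 * j by omega, show j + 1 - 1 = j by omega,
    ← Nat.centralBinom_eq_two_mul_choose, ← h1, pow_succ, pow_mul, pow_succ]
  push_cast
  field_simp
  ring

end Shape

/-! ### Marks on the edges, given the shape of the tree -/

/-- The Laplace transform of `Exp(2)`. The truncation `max s 0` matches `ENNReal.ofReal` in the
length of an edge, so positivity of the lengths is not needed at this point. -/
theorem integral_exp_neg_expMeasure {c : ℝ} (hc : 0 ≤ c) :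
    ∫ s, Real.exp (-(c * max s 0)) ∂expMeasure 2 = 2 / (2 + c) := by
  have h1 : ∀ s : ℝ, (gammaPDF 1 2 s).toReal • Real.exp (-(c * max s 0)) =
      (Set.Ici 0).indicator (fun s => 2 * Real.exp (-(2 + c) * s)) s := by
    intro s
    have h2 : gammaPDF 1 2 s = exponentialPDF 2 s := rfl
    rw [h2, exponentialPDF_eq]
    by_cases hs : 0 ≤ s
    · rw [Set.indicator_of_mem (by exact hs), if_pos hs, ENNReal.toReal_ofReal (by positivity),
        max_eq_left hs, smul_eq_mul, mul_assoc, ← Real.exp_add]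
      ring_nf
    · rw [Set.indicator_of_notMem (by exact hs), if_neg hs]
      simp
  rw [expMeasure, gammaMeasure, integral_withDensity_eq_integral_toReal_smul
    (by exact (measurable_gammaPDFReal 1 2).ennreal_ofReal)
    (by simp [gammaPDF])]
  simp_rw [h1]
  rw [integral_indicator measurableSet_Ici, integral_Ici_eq_integral_Ioi, integral_const_mul,
    integral_exp_mul_Ioi (by linarith), mul_zero, Real.exp_zero, neg_div_neg_eq, mul_one_div]

/-- The edge with upper end `v`. -/
def edge (v : List ℕ) : Set (List ℕ × ℝ) := {p | p.1 = v}

theorem measurablePoints_edge (v : List ℕ) : MeasurablePoints (edge v) := fun w =>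
  MeasurableSet.const (w = v)

theorem measurablePoints_univ : MeasurablePoints Set.univ := fun _ => MeasurableSet.univ

theorem branchLength_edge (κ : List ℕ → ℝ) {x v : List ℕ} (h : v <+: x) :
    branchLength κ x (edge v) = ENNReal.ofReal (κ v) := by
  have hv : x.take v.length = v := (List.prefix_iff_eq_take.1 h).symm
  rw [branchLength, Finset.sum_eq_single v.length]
  · rw [hv]
    have : {s : ℝ | (v, s) ∈ edge v ∩ branch κ x} = Set.Ioc 0 (κ v) := by
      ext s
      simp [edge, branch, h]
    rw [this, Real.volume_Ioc, sub_zero]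
  · intro i hi hne
    have : {s : ℝ | (x.take i, s) ∈ edge v ∩ branch κ x} = ∅ := by
      refine Set.eq_empty_of_forall_notMem fun s hs => hne ?_
      have h1 : x.take i = v := hs.1
      rw [← h1, List.length_take]
      rw [Finset.mem_range] at hi
      omega
    rw [this, measure_empty]
  · intro hn
    rw [Finset.mem_range] at hn
    have := h.length_le
    omega

theorem encard_inter_edge_eq_zero_iff {A : Set (List ℕ × ℝ)} {v : List ℕ} :
    (A ∩ edge v).encard = 0 ↔ ∀ s, (v, s) ∉ A := by
  rw [Set.encard_eq_zero, Set.eq_empty_iff_forall_notMem]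
  constructor
  · exact fun h s hs => h (v, s) ⟨hs, rfl⟩
  · rintro h ⟨w, s⟩ ⟨hs, hw⟩
    rw [show w = v from hw] at hs
    exact h s hs

section Marks

variable {Ω : Type*} {G : Ω → Set (List ℕ)} {κ : List ℕ → Ω → ℝ}

theorem measurableSet_sigmaTree_mem (v : List ℕ) :
    MeasurableSet[sigmaTree G κ] {ω | v ∈ G ω} := by
  refine (le_sup_left : _ ≤ sigmaTree G κ) _ (le_iSup (fun v =>
    MeasurableSpace.comap (fun ω => v ∈ G ω) inferInstance) v _ ⟨{True}, trivial, ?_⟩)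
  ext ω
  simp

theorem measurableSet_sigmaTree_eq (T : Set (List ℕ)) :
    MeasurableSet[sigmaTree G κ] {ω | G ω = T} := by
  have : {ω | G ω = T} = ⋂ u, {ω | u ∈ G ω ↔ u ∈ T} := by
    ext ξ
    simp [Set.ext_iff]
  rw [this]
  exact MeasurableSet.iInter fun u => (measurableSet_sigmaTree_mem u).iff (.const _)

theorem measurableSet_sigmaTree_nodes (x : List ℕ) :
    MeasurableSet[sigmaTree G κ] {ω | x ∈ nodes (G ω)} := by
  have : {ω | x ∈ nodes (G ω)} = {ω | x ∈ G ω} ∩ ⋃ i, {ω | x ++ [i] ∈ G ω} := by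
    ext ω
    simp only [nodes, leaves, Set.mem_ofPred_eq, Set.mem_sdiff, Set.mem_inter_iff, Set.mem_iUnion]
    refine and_congr_right fun h => ?_
    simp [h]
  rw [this]
  exact (measurableSet_sigmaTree_mem x).inter
    (MeasurableSet.iUnion fun i => measurableSet_sigmaTree_mem _)

variable [MeasurableSpace Ω] {P : Measure Ω} {n : ℕ} {ξ : List ℕ → Ω → ℕ}
  {π : List ℕ → Ω → Set (List ℕ × ℝ)}

theorem measurableSet_mem_treeOf (u : List ℕ) : MeasurableSet {ξ : List ℕ → ℕ | u ∈ treeOf ξ} := by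
  have : {ξ : List ℕ → ℕ | u ∈ treeOf ξ} =
      ⋂ v, ⋂ i, ⋂ _ : v ++ [i] <+: u, {ξ : List ℕ → ℕ | i < ξ v} := by
    ext ξ
    simp [treeOf]
  rw [this]
  exact MeasurableSet.iInter fun v => MeasurableSet.iInter fun i => MeasurableSet.iInter fun _ =>
    measurableSet_lt measurable_const (measurable_pi_apply v)

theorem measurableSet_treeOf_eq (T : Set (List ℕ)) :
    MeasurableSet {ξ : List ℕ → ℕ | treeOf ξ = T} := by
  have : {ξ : List ℕ → ℕ | treeOf ξ = T} = ⋂ u, {ξ : List ℕ → ℕ | u ∈ treeOf ξ ↔ u ∈ T} := by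
    ext ξ
    simp [Set.ext_iff]
  rw [this]
  exact MeasurableSet.iInter fun u => (measurableSet_mem_treeOf u).iff (.const _)

theorem sigmaTree_le (hξ : ∀ v, Measurable (ξ v)) (hG : ∀ ω, G ω = treeOf fun v => ξ v ω)
    (hκ : ∀ v, Measurable (κ v)) : sigmaTree G κ ≤ ‹MeasurableSpace Ω› := by
  refine sup_le (iSup_le fun v => Measurable.comap_le ?_) (iSup_le fun v => (hκ v).comap_le)
  rw [← measurableSet_setOfPred]
  simp_rw [hG]
  exact (measurable_pi_lambda (fun ω v => ξ v ω) hξ) (measurableSet_mem_treeOf v)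

theorem setIntegral_condExp_indicator {Ω : Type*} {m mΩ : MeasurableSpace Ω} {P : Measure Ω}
    [IsProbabilityMeasure P] (hm : m ≤ mΩ) {A B : Set Ω} (hA : MeasurableSet A)
    (hB : MeasurableSet[m] B) : ∫ ω in B, (P⟦A | m⟧) ω ∂P = P.real (B ∩ A) := by
  rw [setIntegral_condExp hm ((integrable_const 1).indicator hA) hB,
    setIntegral_indicator hA, setIntegral_const, smul_eq_mul, mul_one]

/-- The conditional probabilities of the finite counts are Poisson weights, which sum to 1; no
probability is left for an infinite count. -/
theorem ae_finite_marks [IsProbabilityMeasure P] (hm : sigmaTree G κ ≤ ‹MeasurableSpace Ω›)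
    (hπ : IsPoissonMarks P n G κ π) : ∀ᵐ ω ∂P, ∀ x ∈ nodes (G ω), (π x ω).Finite := by
  rw [ae_all_iff]
  intro x
  set B : Set Ω := {ω | x ∈ nodes (G ω)} with hB
  have hBm : MeasurableSet[sigmaTree G κ] B := measurableSet_sigmaTree_nodes x
  let N : ℕ → Set Ω := fun k => {ω | (π x ω ∩ Set.univ).encard = (k : ℕ∞)}
  have hN : ∀ k, MeasurableSet (N k) := fun k =>
    hπ.measurable x _ measurablePoints_univ (measurableSet_singleton _)
  have hlaw : ∀ᵐ ω ∂P, ω ∈ B → ∀ k, (P⟦N k | sigmaTree G κ⟧) ω = (poissonMeasure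
      ((branchLength (fun v => κ v ω) x Set.univ).toNNReal / n)).real {k} := by
    have : ∀ k, ∀ᵐ ω ∂P, ω ∈ B → (P⟦N k | sigmaTree G κ⟧) ω = (poissonMeasure
      ((branchLength (fun v => κ v ω) x Set.univ).toNNReal / n)).real {k} := by
      intro k
      have h := hπ.cond_law 1 (fun _ => x) (fun _ => Set.univ) (fun _ => k)
        (fun _ => measurablePoints_univ) (fun i j hij => absurd (Subsingleton.elim i j) hij)
      filter_upwards [h] with ω hω hωB
      simpa [N] using hω fun _ => hωB
    filter_upwards [ae_all_iff.2 this] with ω hω hωB k using hω k hωB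
  have hsum : ∑' k, P (B ∩ N k) = P B := by
    have h1 : ∀ k, P (B ∩ N k)
        = ∫⁻ ω in B, ENNReal.ofReal ((P⟦N k | sigmaTree G κ⟧) ω) ∂P := by
      intro k
      rw [← ofReal_integral_eq_lintegral_ofReal integrable_condExp.integrableOn,
        setIntegral_condExp_indicator hm (hN k) hBm, ofReal_measureReal]
      refine (ae_restrict_iff' (hm _ hBm)).2 ?_
      filter_upwards [hlaw] with ω hω hωB
      rw [hω hωB]
      exact measureReal_nonneg
    simp_rw [h1]
    rw [← lintegral_tsum fun k => (integrable_condExp.aestronglyMeasurable.aemeasurable.restrict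
      ).ennreal_ofReal, setLIntegral_congr_fun_ae (g := fun _ => 1) (hm _ hBm)]
    · simp
    · filter_upwards [hlaw] with ω hω hωB
      simp_rw [hω hωB, poissonMeasure_real_singleton]
      rw [← ENNReal.ofReal_tsum_of_nonneg (fun k => by positivity)
        (hasSum_one_poissonMeasure _).summable, (hasSum_one_poissonMeasure _).tsum_eq,
        ENNReal.ofReal_one]
  rw [← measure_iUnion _ fun k => (hm _ hBm).inter (hN k)] at hsum
  · have hae := ae_eq_of_subset_of_measure_ge (Set.iUnion_subset fun k => Set.inter_subset_left)
      hsum.ge (MeasurableSet.iUnion fun k => (hm _ hBm).inter (hN k)).nullMeasurableSet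
      (measure_ne_top P B)
    filter_upwards [hae.mem_iff] with ω hω hωB
    obtain ⟨k, -, hk⟩ := Set.mem_iUnion.1 (hω.2 hωB)
    have hk' : (π x ω ∩ Set.univ).encard = (k : ℕ∞) := hk
    rw [Set.inter_univ] at hk'
    exact Set.finite_of_encard_eq_coe hk'
  · intro i j hij
    refine Set.disjoint_left.2 fun ω h h' => hij ?_
    have h1 : (π x ω ∩ Set.univ).encard = (i : ℕ∞) := h.2
    have h2 : (π x ω ∩ Set.univ).encard = (j : ℕ∞) := h'.2
    exact Nat.cast_injective (h1.symm.trans h2)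

theorem ae_pos_lengths [IsProbabilityMeasure P] (hκ : IsExpLengths P ξ κ) :
    ∀ᵐ ω ∂P, ∀ v, 0 < κ v ω := by
  rw [ae_all_iff]
  intro v
  have h : ∀ᵐ s ∂P.map (κ v), 0 < s := by
    rw [hκ.law, ae_iff]
    have := isProbabilityMeasure_expMeasure (r := 2) two_pos
    have h1 := cdf_expMeasure_eq (r := 2) two_pos 0
    rw [cdf_eq_real] at h1
    simp only [not_lt]
    have h2 : (expMeasure 2).real (Set.Iic 0) = 0 := by simpa using h1
    exact (measureReal_eq_zero_iff).1 h2
  exact ae_of_ae_map (hκ.measurable v).aemeasurable h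

theorem integral_prod_exp_lengths [IsProbabilityMeasure P] (hκ : IsExpLengths P ξ κ)
    (V : Finset (List ℕ)) (c : List ℕ → ℕ) :
    ∫ ω, ∏ v ∈ V, Real.exp (-((c v : ℝ) / n * max (κ v ω) 0)) ∂P = ∏ v ∈ V, keep n (c v) := by
  have h := (hκ.indep.precomp (Subtype.val_injective (p := (· ∈ V)))).integral_fun_prod_comp
    (X := fun v : V => κ v) (f := fun v s => Real.exp (-((c v : ℝ) / n * max s 0)))
    (fun v => (hκ.measurable v).aemeasurable)
    (fun v => (by fun_prop : Continuous _).aestronglyMeasurable)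
  rw [← Finset.prod_coe_sort V fun v => keep n (c v)]
  refine (integral_congr_ae (.of_forall fun ω => (Finset.prod_coe_sort V fun v =>
    Real.exp (-((c v : ℝ) / n * max (κ v ω) 0))).symm)).trans (h.trans ?_)
  refine Finset.prod_congr rfl fun v _ => ?_
  rw [← integral_map (f := fun s => Real.exp (-((c v : ℝ) / n * max s 0)))
    (hκ.measurable v).aemeasurable (by fun_prop : Continuous _).aestronglyMeasurable, hκ.law,
    integral_exp_neg_expMeasure (by positivity), keep]

end Marks

/-! ### The leaf law of the pruned tree. -/

section Pruned

variable {Ω : Type*} [MeasurableSpace Ω] {P : Measure Ω} [IsProbabilityMeasure P] {n : ℕ}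
  {ξ : List ℕ → Ω → ℕ} {G : Ω → Set (List ℕ)} {κ : List ℕ → Ω → ℝ}
  {π : List ℕ → Ω → Set (List ℕ × ℝ)}

/-- Conditionally on tree and lengths, the void probabilities multiply to a function of the lengths
alone. The lengths are independent of the shape, so its integral over the shape event factors, and
independence between edges then gives the product of the `keep` factors. -/
theorem measure_shapeEvent_inter_noMarks (hξ : IsCriticalBinaryGW P ξ)
    (hG : ∀ ω, G ω = treeOf fun v => ξ v ω) (hκ : IsExpLengths P ξ κ)
    (hπ : IsPoissonMarks P n G κ π) (t : BinaryTree Unit) (V : Finset (List ℕ))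
    (S : List ℕ → Finset (List ℕ))
    (hS : ∀ v ∈ V, S v ⊆ innerVertices t [] ∧ ∀ x ∈ S v, v <+: x) :
    P.real (shapeEvent ξ t ∩ ⋂ v ∈ V, noMarks (fun ω x v => ∀ s, (v, s) ∉ π x ω) v (S v))
      = P.real (shapeEvent ξ t) * ∏ v ∈ V, keep n (S v).card := by
  have hm := sigmaTree_le hξ.measurable hG hκ.measurable
  have hE : shapeEvent ξ t = {ω | G ω = vertices t []} := by
    simp_rw [hG]
    rfl
  -- The conditional law is stated for families indexed by `Fin r`, so the pairs (edge, sender) are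
  -- enumerated.
  let e := (V.sigma fun v => S v).equivFin.symm
  let x : Fin (V.sigma fun v => S v).card → List ℕ := fun j => (e j).1.2
  let y : Fin (V.sigma fun v => S v).card → List ℕ := fun j => (e j).1.1
  have hmem : ∀ j, y j ∈ V ∧ x j ∈ S (y j) := fun j => Finset.mem_sigma.1 (e j).2
  have hset : (⋂ v ∈ V, noMarks (fun ω x v => ∀ s, (v, s) ∉ π x ω) v (S v)) =
      {ω | ∀ j, (π (x j) ω ∩ edge (y j)).encard = ((0 : ℕ) : ℕ∞)} := by
    ext ω
    simp only [noMarks, Set.mem_iInter, Set.mem_ofPred_eq, Nat.cast_zero,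
      encard_inter_edge_eq_zero_iff]
    constructor
    · exact fun h j => h _ (hmem j).1 _ (hmem j).2
    · intro h v hv z hz
      have := h (e.symm ⟨⟨v, z⟩, Finset.mem_sigma.2 ⟨hv, hz⟩⟩)
      simpa [x, y] using this
  have hmeas : MeasurableSet {ω | ∀ j, (π (x j) ω ∩ edge (y j)).encard = ((0 : ℕ) : ℕ∞)} := by
    simp only [Set.ofPred_forall]
    exact MeasurableSet.iInter fun j => hπ.measurable _ _ (measurablePoints_edge _)
      (measurableSet_singleton _)
  have hlaw := hπ.cond_law _ x (fun j => edge (y j)) (fun _ => 0)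
    (fun j => measurablePoints_edge _) fun i j hij hx => Set.disjoint_left.2 fun p hp hp' => by
      refine hij (e.injective (Subtype.ext (Sigma.ext ?_ (heq_of_eq hx))))
      exact (show p.1 = y i from hp).symm.trans hp'
  have hval : ∀ ω, ∏ j, (poissonMeasure ((branchLength (fun v => κ v ω) (x j)
      (edge (y j))).toNNReal / n)).real {0} =
      ∏ v ∈ V, Real.exp (-(((S v).card : ℝ) / n * max (κ v ω) 0)) := by
    intro ω
    have h1 : ∀ j, (poissonMeasure ((branchLength (fun v => κ v ω) (x j)
        (edge (y j))).toNNReal / n)).real {0} = Real.exp (-(max (κ (y j) ω) 0 / n)) := by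
      intro j
      rw [branchLength_edge _ ((hS _ (hmem j).1).2 _ (hmem j).2), poissonMeasure_real_singleton]
      simp [ENNReal.ofReal, Real.coe_toNNReal']
    simp_rw [h1]
    rw [e.prod_comp fun p : (V.sigma fun v => S v) => Real.exp (-(max (κ p.1.1 ω) 0 / n)),
      Finset.prod_coe_sort (V.sigma fun v => S v) fun p => Real.exp (-(max (κ p.1 ω) 0 / n)),
      Finset.prod_sigma]
    refine Finset.prod_congr rfl fun v _ => ?_
    dsimp only
    rw [Finset.prod_const, ← Real.exp_nat_mul]
    ring_nf
  have hEm : MeasurableSet[sigmaTree G κ] (shapeEvent ξ t) := by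
    rw [hE]
    exact measurableSet_sigmaTree_eq _
  have hξm : Measurable fun ω v => ξ v ω := measurable_pi_lambda _ hξ.measurable
  rw [hset, ← setIntegral_condExp_indicator hm hmeas hEm,
    setIntegral_congr_ae (g := fun ω => ∏ v ∈ V,
      Real.exp (-(((S v).card : ℝ) / n * max (κ v ω) 0))) (hm _ hEm)]
  · rw [← integral_prod_exp_lengths hκ]
    exact Indep.setIntegral_eq_mul (X := fun ω v => κ v ω) (f := fun k : List ℕ → ℝ => ∏ v ∈ V,
      Real.exp (-(((S v).card : ℝ) / n * max (k v) 0))) hξm.comap_le hκ.indep_tree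
      (measurable_pi_lambda _ hκ.measurable).aemeasurable
      ⟨_, measurableSet_treeOf_eq (vertices t []), rfl⟩
      (by fun_prop : Measurable _).aestronglyMeasurable
  · filter_upwards [hlaw] with ω hω hωE
    rw [hω, hval]
    intro j
    rw [hE] at hωE
    rw [show G ω = vertices t [] from hωE, nodes_vertices]
    exact (hS _ (hmem j).1).1 (hmem j).2

theorem measure_encard_leaves_prune_inter_shapeEvent (hξ : IsCriticalBinaryGW P ξ)
    (hG : ∀ ω, G ω = treeOf fun v => ξ v ω) (hκ : IsExpLengths P ξ κ)
    (hπ : IsPoissonMarks P n G κ π) (t : BinaryTree Unit) (j : ℕ) :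
    P ({ω | (leaves (prune (fun v => κ v ω) (fun x => π x ω) (G ω))).encard
      = ((j + 1 : ℕ) : ℕ∞)} ∩ shapeEvent ξ t) = weight t * survivorLaw n t j := by
  have hm := sigmaTree_le hξ.measurable hG hκ.measurable
  have hEm := measurableSet_shapeEvent hξ t
  have hE0 : P (shapeEvent ξ t) ≠ 0 := by
    rw [measure_shapeEvent hξ]
    exact weight_ne_zero t
  have := cond_isProbabilityMeasure hE0
  let Z : Ω → List ℕ → List ℕ → Prop := fun ω x v => ∀ s, (v, s) ∉ π x ω
  have hsurv : (P[|shapeEvent ξ t]) {ω | (survivors (Z ω) t []).card = j} = survivorLaw n t j := by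
    refine measure_card_survivors (I := innerVertices t []) (fun v S _ => ?_) (fun V S hS => ?_)
      subset_rfl j
    · have : noMarks Z v S = ⋂ x ∈ S, {ω | (π x ω ∩ edge v).encard = 0} := by
        ext ω
        simp only [noMarks, Z, Set.mem_ofPred_eq, Set.mem_iInter, encard_inter_edge_eq_zero_iff]
      rw [this]
      exact Finset.measurableSet_biInter _ fun x _ =>
        hπ.measurable _ _ (measurablePoints_edge _) (measurableSet_singleton _)
    · have h := measure_shapeEvent_inter_noMarks hξ hG hκ hπ t V S hS
      rw [cond_apply hEm, ← ENNReal.ofReal_prod_of_nonneg fun v _ => (keep_pos n _).le,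
        ← ofReal_measureReal (s := shapeEvent ξ t ∩ _), h,
        ENNReal.ofReal_mul measureReal_nonneg, ofReal_measureReal, ← mul_assoc,
        ENNReal.inv_mul_cancel hE0 (measure_ne_top _ _), one_mul]
  rw [← hsurv, mul_comm, ← measure_shapeEvent hξ, cond_mul_eq_inter hEm, Set.inter_comm]
  -- The leaf count and the survivor count are related only almost surely: the combinatorial
  -- identity needs finitely many marks and positive lengths.
  refine measure_congr ?_
  filter_upwards [ae_finite_marks hm hπ, ae_pos_lengths hκ] with ω hfin hpos
  refine propext (and_congr_right fun hω => ?_)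
  have hGω : G ω = vertices t [] := (hG ω).trans hω
  have hnodes : ∀ x ∈ innerVertices t [], x ∈ nodes (G ω) := fun x hx => by
    rw [hGω, nodes_vertices]
    exact hx
  change (leaves (prune (fun v => κ v ω) (fun x => π x ω) (G ω))).encard
      = ((j + 1 : ℕ) : ℕ∞) ↔ (survivors (Z ω) t []).card = j
  rw [hGω, encard_leaves_prune hpos (fun x hx => hπ.subset_branch x ω (hnodes x hx))
    fun x hx => hfin x (hnodes x hx), Nat.cast_inj]
  exact Nat.add_right_cancel_iff

theorem measure_encard_leaves_prune (hξ : IsCriticalBinaryGW P ξ)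
    (hG : ∀ ω, G ω = treeOf fun v => ξ v ω) (hκ : IsExpLengths P ξ κ)
    (hπ : IsPoissonMarks P n G κ π) {k : ℕ} (hk : 1 ≤ k) :
    P.real {ω | (leaves (prune (fun v => κ v ω) (fun x => π x ω) (G ω))).encard = (k : ℕ∞)}
      = leafLaw n k := by
  obtain ⟨j, rfl⟩ := Nat.exists_eq_add_of_le' hk
  rw [measureReal_def, measure_eq_tsum_shape hξ, leafLaw_succ, prunedLaw_apply]
  simp_rw [measure_encard_leaves_prune_inter_shapeEvent hξ hG hκ hπ]

end Pruned

end ForestFire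

theorem mainTheorem4 {Ω : Type*} [MeasurableSpace Ω] (P : Measure Ω) [IsProbabilityMeasure P]
    (n : ℕ) (hn : 1 ≤ n) (ξ : List ℕ → Ω → ℕ) (G : Ω → Set (List ℕ))
    (hξ : ForestFire.IsCriticalBinaryGW P ξ)
    (hG : ∀ ω, G ω = ForestFire.treeOf (fun v => ξ v ω)) :
    (∀ᵐ ω ∂P, (G ω).Finite) ∧
    (∀ k : ℕ, 1 ≤ k →
      P.real {ω | (ForestFire.leaves (G ω)).encard = (k : ℕ∞)} = ForestFire.criticalLaw k) ∧
    ∃ c : ℕ → ℝ, ForestFire.IsEquilibrium n c ∧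
      (∀ c' : ℕ → ℝ, ForestFire.IsEquilibrium n c' → c' = c) ∧
      ∀ (κ : List ℕ → Ω → ℝ) (π : List ℕ → Ω → Set (List ℕ × ℝ)),
        ForestFire.IsExpLengths P ξ κ → ForestFire.IsPoissonMarks P n G κ π →
        (∀ᵐ ω ∂P, ∀ x ∈ ForestFire.nodes (G ω), (π x ω).Finite) ∧
        ∀ k : ℕ, 1 ≤ k →
          P.real {ω | (ForestFire.leaves
              (ForestFire.prune (fun v => κ v ω) (fun x => π x ω) (G ω))).encard = (k : ℕ∞)}
            = c k / ForestFire.moment 0 c := by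
  refine ⟨?_, fun k hk => ?_, ?_⟩
  · filter_upwards [ForestFire.ae_exists_shape hξ] with ω ⟨t, ht⟩
    rw [hG ω, show ForestFire.treeOf (fun v => ξ v ω) = ForestFire.vertices t [] from ht]
    exact Finset.finite_toSet _
  · simp_rw [hG]
    exact ForestFire.measure_encard_leaves hξ hk
  · obtain ⟨c, hc⟩ := ForestFire.exists_isEquilibrium hn
    refine ⟨c, hc, fun c' hc' => hc.unique hc', fun κ π hκ hπ => ⟨?_, fun k hk => ?_⟩⟩
    · exact ForestFire.ae_finite_marks
        (ForestFire.sigmaTree_le hξ.measurable hG hκ.measurable) hπ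
    · rw [hc.div_moment_eq, ForestFire.measure_encard_leaves_prune hξ hG hκ hπ hk]
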